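/- For positive integers $k,\ell$ let the Ramsey number $R(k,\ell)$ be the smallest positive integer $n$ such that every graph on $n$ vertices contains a clique of size $k$ or an independent set of size $\ell$. For each $\varepsilon\in(0,1/2)$ there is a constant $c_\varepsilon>0$ such that \[R(k+1,\ell+1)\le e^{-c_\varepsilon(\log k)^2}\binom{k+\ell}{k}\] for all positive integers $k,\ell$ with $\ell/k\in[\varepsilon,1]$ and $\ell\ge c_\varepsilon^{-1}$. -/

import Mathlib

/-- Every simple graph on `n` labelled vertices contains a clique of size `k` or an independent
set of size `l`. -/
def RamseyProperty (k l n : ℕ) : Prop :=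
  ∀ G : SimpleGraph (Fin n),
    (∃ s : Finset (Fin n), G.IsNClique k s) ∨ (∃ t : Finset (Fin n), G.IsNIndepSet l t)

/-- The Ramsey number `R(k, l)`: the smallest positive integer `n` such that every graph on `n`
vertices contains a clique of size `k` or an independent set of size `l`. The infimum is attained,
see `ramseyNumber_isLeast`. -/
noncomputable def ramseyNumber (k l : ℕ) : ℕ :=
  sInf {n : ℕ | 0 < n ∧ RamseyProperty k l n}

theorem exists_clique_or_indepSet_of_card (k l : ℕ) :
    ∃ n : ℕ, 0 < n ∧ ∀ (V : Type) (G : SimpleGraph V) (A : Finset V), n ≤ A.card →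
      (∃ s ⊆ A, G.IsNClique k s) ∨ (∃ t ⊆ A, G.IsNIndepSet l t) := by
  classical
  induction k generalizing l with
  | zero =>
    refine ⟨1, one_pos, fun V G A _ => Or.inl ⟨∅, Finset.empty_subset _, ?_⟩⟩
    simp
  | succ k ihk =>
    induction l with
    | zero =>
      refine ⟨1, one_pos, fun V G A _ => Or.inr ⟨∅, Finset.empty_subset _, ?_⟩⟩
      rw [← SimpleGraph.isNClique_compl]
      simp
    | succ l ihl =>
      obtain ⟨a, ha, hA⟩ := ihk (l + 1)
      obtain ⟨b, hb, hB⟩ := ihl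
      refine ⟨a + b, by omega, fun V G A hcard => ?_⟩
      obtain ⟨v, hv⟩ : A.Nonempty := Finset.card_pos.mp (by omega)
      have hsplit := Finset.card_filter_add_card_filter_not (s := A.erase v) (fun w => G.Adj v w)
      rw [Finset.card_erase_of_mem hv] at hsplit
      have hsub : ∀ (p : V → Prop) [DecidablePred p], (A.erase v).filter p ⊆ A := fun p _ =>
        (Finset.filter_subset _ _).trans (Finset.erase_subset _ _)
      by_cases h : a ≤ ((A.erase v).filter (fun w => G.Adj v w)).card
      · rcases hA V G _ h with ⟨s, hs, hs'⟩ | ⟨t, ht, ht'⟩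
        · refine Or.inl ⟨insert v s, ?_, ?_⟩
          · exact Finset.insert_subset hv (hs.trans (hsub _))
          · exact hs'.insert fun w hw => (Finset.mem_filter.mp (hs hw)).2
        · exact Or.inr ⟨t, ht.trans (hsub _), ht'⟩
      · have h2 : b ≤ ((A.erase v).filter (fun w => ¬ G.Adj v w)).card := by omega
        rcases hB V G _ h2 with ⟨s, hs, hs'⟩ | ⟨t, ht, ht'⟩
        · exact Or.inl ⟨s, hs.trans (hsub _), hs'⟩
        · refine Or.inr ⟨insert v t, ?_, ?_⟩
          · exact Finset.insert_subset hv (ht.trans (hsub _))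
          · rw [← SimpleGraph.isNClique_compl] at ht' ⊢
            refine ht'.insert fun w hw => ?_
            have hw' := Finset.mem_filter.mp (ht hw)
            rw [SimpleGraph.compl_adj]
            exact ⟨(Finset.ne_of_mem_erase hw'.1).symm, hw'.2⟩

/-- Ramsey numbers are well defined (Ramsey's theorem for graphs). -/
theorem ramseyNumber_isLeast (k l : ℕ) :
    IsLeast {n : ℕ | 0 < n ∧ RamseyProperty k l n} (ramseyNumber k l) := by
  obtain ⟨n, hn, h⟩ := exists_clique_or_indepSet_of_card k l
  have hne : {n : ℕ | 0 < n ∧ RamseyProperty k l n}.Nonempty := by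
    refine ⟨n, hn, fun G => ?_⟩
    rcases h (Fin n) G Finset.univ (by simp) with ⟨s, _, hs⟩ | ⟨t, _, ht⟩
    · exact Or.inl ⟨s, hs⟩
    · exact Or.inr ⟨t, ht⟩
  exact ⟨Nat.sInf_mem hne, fun m hm => Nat.sInf_le hm⟩

/-! The argument yields a saving exponential in `N = k + l`, which suffices because `(log k)^2 ≤
4k`. A graph and its complement are treated as two colours `H true`, `H false`, with target clique
sizes `k i + 1`.

Erdős–Szekeres passes to a neighbourhood in colour `i` at the cost of a factor `k i / N`. If some
vertex has colour degree at least `δ|A|` below this proportion, its neighbourhood in the other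
colour beats Erdős–Szekeres by a factor `1 + δ/2`. About `κN` such gains already give the
exponential saving (`exists_hasMonoClique_of_exp_mul_binom_le`). Otherwise an almost regular
colouring is reached, and there `exists_book` finds a monochromatic clique on `t` vertices, `t` a
small multiple of `N`, with nearly `(k i / N)^t |A|` common neighbours. Replacing `k i` by `k i - t`
divides the binomial coefficient by more than `(N / k i)^t`, by a factor `exp (Ω(t²/N))`
(`binom_update_sub_le`), so Erdős–Szekeres finishes inside the pages.

The book is built from a reservoir `X` and page sets `Y true`, `Y false`. By positivity of Gram
kernels (`exists_large_correlatedSet`), some `x ∈ X` and some large `X' ⊆ X` have codegrees with `x`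
not much below expectation in both colours simultaneously. If `X'` is as small as `exp (-3j) |X| /
400`, one colour has excess of order `j²`. For small `j`, `x` joins the clique of its majority
colour in `X'`; for large `j`, the density of a colour is boosted. Densities are at most 1, so
boosts are rare. -/

/-! ### Gram kernels and the function `cosh √x` -/

/-- A kernel on `V` which is a Gram kernel of finitely many real feature functions. -/
def IsGramKernel {V : Type} (K : V → V → ℝ) : Prop :=
  ∃ (ι : Type) (W : Finset ι) (σ : ι → V → ℝ), ∀ x y, K x y = ∑ w ∈ W, σ w x * σ w y

namespace IsGramKernel

variable {V : Type} {K L : V → V → ℝ}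

theorem one : IsGramKernel (fun _ _ : V => (1 : ℝ)) :=
  ⟨Unit, Finset.univ, fun _ _ => 1, fun _ _ => by simp⟩

theorem mul (hK : IsGramKernel K) (hL : IsGramKernel L) :
    IsGramKernel (fun x y => K x y * L x y) := by
  obtain ⟨ι, W, σ, hσ⟩ := hK
  obtain ⟨κ, U, ρ, hρ⟩ := hL
  refine ⟨ι × κ, W ×ˢ U, fun w x => σ w.1 x * ρ w.2 x, fun x y => ?_⟩
  simp only [hσ, hρ]
  rw [Finset.sum_mul_sum, Finset.sum_product]
  refine Finset.sum_congr rfl fun i _ => Finset.sum_congr rfl fun j _ => ?_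
  ring

theorem pow (hK : IsGramKernel K) (n : ℕ) : IsGramKernel (fun x y => K x y ^ n) := by
  induction n with
  | zero => simpa using one
  | succ n ih => simpa only [pow_succ] using ih.mul hK

theorem sum_nonneg (hK : IsGramKernel K) (X : Finset V) :
    0 ≤ ∑ x ∈ X, ∑ y ∈ X, K x y := by
  obtain ⟨ι, W, σ, hσ⟩ := hK
  have : ∑ x ∈ X, ∑ y ∈ X, K x y = ∑ w ∈ W, (∑ x ∈ X, σ w x) ^ 2 := by
    simp only [hσ, sq, Finset.sum_mul_sum]
    exact (Finset.sum_congr rfl fun _ _ => Finset.sum_comm).trans Finset.sum_comm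
  rw [this]
  positivity

end IsGramKernel

/-- The entire function `∑ xⁿ / (2n)!`, that is, `cosh √x` continued to the real line. -/
noncomputable def coshSqrt (x : ℝ) : ℝ :=
  if 0 ≤ x then Real.cosh (Real.sqrt x) else Real.cos (Real.sqrt (-x))

theorem hasSum_coshSqrt (x : ℝ) :
    HasSum (fun n : ℕ => x ^ n / ((2 * n).factorial : ℝ)) (coshSqrt x) := by
  unfold coshSqrt
  split_ifs with h
  · have := Real.hasSum_cosh (Real.sqrt x)
    simpa only [pow_mul, Real.sq_sqrt h] using this
  · have := Real.hasSum_cos (Real.sqrt (-x))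
    have h' : 0 ≤ -x := by linarith
    simp only [pow_mul, Real.sq_sqrt h'] at this
    convert this using 2 with n
    rw [← mul_pow]
    simp

theorem neg_one_le_coshSqrt (x : ℝ) : -1 ≤ coshSqrt x := by
  unfold coshSqrt
  split_ifs
  · linarith [Real.one_le_cosh (Real.sqrt x)]
  · exact Real.neg_one_le_cos _

theorem coshSqrt_le_one {x : ℝ} (h : x ≤ 0) : coshSqrt x ≤ 1 := by
  unfold coshSqrt
  split_ifs with h0
  · simp [le_antisymm h h0]
  · exact Real.cos_le_one _

theorem coshSqrt_le_exp (x : ℝ) : coshSqrt x ≤ Real.exp (Real.sqrt x) := by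
  unfold coshSqrt
  split_ifs with h0
  · rw [Real.cosh_eq]
    have : Real.exp (-Real.sqrt x) ≤ Real.exp (Real.sqrt x) :=
      Real.exp_le_exp.2 (by linarith [Real.sqrt_nonneg x])
    linarith
  · exact (Real.cos_le_one _).trans (Real.one_le_exp (Real.sqrt_nonneg x))

/-- The first three Taylor terms suffice: `3 + x/2 + x²/24 - x` is `((x - 6)² + 36) / 24`. -/
theorem le_two_add_coshSqrt {x : ℝ} (h : 0 ≤ x) : x ≤ 2 + coshSqrt x := by
  have hs := hasSum_coshSqrt x
  have := sum_le_hasSum (Finset.range 3) (fun n _ => by positivity) hs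
  simp [Finset.sum_range_succ, Nat.factorial] at this
  nlinarith [sq_nonneg (x - 6)]

theorem le_two_mul_exp_sqrt (x : ℝ) : x ≤ 2 * Real.exp (Real.sqrt x) := by
  rcases le_or_gt x 0 with h | h
  · linarith [Real.exp_pos (Real.sqrt x)]
  · have := Real.quadratic_le_exp_of_nonneg (Real.sqrt_nonneg x)
    have h2 := Real.sq_sqrt h.le
    nlinarith [Real.sqrt_nonneg x]

/-- The Taylor coefficients of `coshSqrt` are nonnegative and products of Gram kernels are Gram, so
each term of the series has a nonnegative sum. -/
theorem IsGramKernel.sum_mul_coshSqrt_nonneg {V : Type} {K L : V → V → ℝ} (hK : IsGramKernel K)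
    (hL : IsGramKernel L) (X : Finset V) :
    0 ≤ ∑ x ∈ X, ∑ y ∈ X, K x y * (2 + coshSqrt (L x y)) := by
  have h : HasSum (fun n : ℕ => ∑ x ∈ X, ∑ y ∈ X,
      K x y * (L x y ^ n / ((2 * n).factorial : ℝ)))
      (∑ x ∈ X, ∑ y ∈ X, K x y * coshSqrt (L x y)) :=
    hasSum_sum fun x _ => hasSum_sum fun y _ => (hasSum_coshSqrt _).mul_left _
  have h0 : 0 ≤ ∑ x ∈ X, ∑ y ∈ X, K x y * coshSqrt (L x y) := by
    refine h.nonneg fun n => ?_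
    have := (hK.mul (hL.pow n)).sum_nonneg X
    have h1 : ∑ x ∈ X, ∑ y ∈ X, K x y * (L x y ^ n / ((2 * n).factorial : ℝ)) =
        (∑ x ∈ X, ∑ y ∈ X, K x y * L x y ^ n) / ((2 * n).factorial : ℝ) := by
      simp only [Finset.sum_div, mul_div_assoc]
    rw [h1]
    positivity
  have h2 := hK.sum_nonneg X
  simp only [mul_add, Finset.sum_add_distrib, ← Finset.sum_mul]
  linarith

/-- Both factors `2 + coshSqrt` are at least 1. If `x < -4` and `y ≥ 0`, then `coshSqrt x ≤ 1` and
`y ≤ 2 + coshSqrt y` bound the sum by `(-4 + 3) (2 + coshSqrt y)`. Thus a very negative value in one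
kernel cannot be offset by the other. -/
theorem coshSqrt_pairing_le_neg_one {x y : ℝ} (h : x < -4 ∨ y < -4) :
    x * (2 + coshSqrt y) + y * (2 + coshSqrt x) ≤ -1 := by
  wlog hx : x < -4 generalizing x y
  · have := this h.symm (h.resolve_left hx)
    linarith
  have hy1 := neg_one_le_coshSqrt y
  have hx1 := neg_one_le_coshSqrt x
  rcases le_or_gt 0 y with hy | hy
  · have h1 := coshSqrt_le_one (x := x) (by linarith)
    have h2 := le_two_add_coshSqrt hy
    nlinarith
  · nlinarith

theorem coshSqrt_pairing_le (x y : ℝ) :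
    x * (2 + coshSqrt y) + y * (2 + coshSqrt x) ≤
      12 * Real.exp (2 * Real.sqrt (max x y)) := by
  have aux : ∀ a b : ℝ, a * (2 + coshSqrt b) ≤ 6 * Real.exp (Real.sqrt a + Real.sqrt b) := by
    intro a b
    have h1 := coshSqrt_le_exp b
    have h2 := le_two_mul_exp_sqrt a
    have h3 := Real.one_le_exp (Real.sqrt_nonneg b)
    have h4 := neg_one_le_coshSqrt b
    rw [Real.exp_add]
    have h5 := Real.exp_pos (Real.sqrt a)
    nlinarith
  have h1 := aux x y
  have h2 := aux y x
  have h3 : Real.exp (Real.sqrt x + Real.sqrt y) ≤ Real.exp (2 * Real.sqrt (max x y)) := by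
    apply Real.exp_le_exp.2
    have := Real.sqrt_le_sqrt (le_max_left x y)
    have := Real.sqrt_le_sqrt (le_max_right x y)
    linarith
  rw [add_comm (Real.sqrt y)] at h2
  linarith

/-! ### The geometric lemma for two Gram kernels -/

open Classical in
/-- The elements `y` of `X` with `Z i x y ≥ -4` for both `i`, and `Z i x y ≥ j²` for the given `i`
in case `j ≠ 0`. -/
noncomputable def correlatedSet {V : Type} (X : Finset V) (Z : Bool → V → V → ℝ) (j : ℕ) (i : Bool)
    (x : V) : Finset V :=
  X.filter fun y => (∀ i, -4 ≤ Z i x y) ∧ (j = 0 ∨ (j : ℝ) ^ 2 ≤ Z i x y)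

/-- The symmetrised pairing of the two kernels has nonnegative sum over `X × X`, but is at most `13
G - 1` pointwise, where `G` vanishes if some kernel is below `-4`. Hence `G` has average at least
`1/13`. If all level sets were small, splitting by the integer part of the square root of the larger
kernel would bound the average of `G` by a geometric series below `1/13`. -/
theorem exists_large_correlatedSet {V : Type} {X : Finset V} (hX : X.Nonempty)
    {Z : Bool → V → V → ℝ} (hZ : ∀ i, IsGramKernel (Z i)) :
    ∃ (j : ℕ) (i : Bool), ∃ x ∈ X,
      1 / 400 * Real.exp (-3 * j) * X.card ≤ (correlatedSet X Z j i x).card := by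
  classical
  by_contra! hcon
  set G : V → V → ℝ := fun x y => if ∀ i, -4 ≤ Z i x y then
    Real.exp (2 * Real.sqrt (max (Z true x y) (Z false x y))) else 0 with hG
  have hn : (0 : ℝ) < X.card := by exact_mod_cast hX.card_pos
  have hlower : (X.card : ℝ) * X.card ≤ 13 * ∑ x ∈ X, ∑ y ∈ X, G x y := by
    have h1 := (hZ true).sum_mul_coshSqrt_nonneg (hZ false) X
    have h2 := (hZ false).sum_mul_coshSqrt_nonneg (hZ true) X
    have h3 : ∑ x ∈ X, ∑ y ∈ X, (Z true x y * (2 + coshSqrt (Z false x y)) +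
        Z false x y * (2 + coshSqrt (Z true x y))) ≤ ∑ x ∈ X, ∑ y ∈ X, (13 * G x y - 1) := by
      refine Finset.sum_le_sum fun x _ => Finset.sum_le_sum fun y _ => ?_
      by_cases hg : ∀ i, -4 ≤ Z i x y
      · have := coshSqrt_pairing_le (Z true x y) (Z false x y)
        have h1 : 1 ≤ Real.exp (2 * Real.sqrt (max (Z true x y) (Z false x y))) :=
          Real.one_le_exp (by positivity)
        simp only [hG, if_pos hg]
        linarith
      · simp only [hG, if_neg hg]
        have : Z true x y < -4 ∨ Z false x y < -4 := by
          by_contra! hc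
          exact hg (Bool.rec hc.2 hc.1)
        linarith [coshSqrt_pairing_le_neg_one this]
    simp only [Finset.sum_add_distrib, Finset.sum_sub_distrib, Finset.sum_const, nsmul_eq_mul,
      mul_one, ← Finset.mul_sum] at h3
    linarith
  obtain ⟨J, hJ⟩ : ∃ J : ℕ, ∀ x ∈ X, ∀ y ∈ X,
      Real.sqrt (max (Z true x y) (Z false x y)) < J := by
    obtain ⟨B, hB⟩ := ((X ×ˢ X).image
      fun q => Real.sqrt (max (Z true q.1 q.2) (Z false q.1 q.2))).bddAbove
    obtain ⟨J, hJ⟩ := exists_nat_gt B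
    refine ⟨J, fun x hx y hy => lt_of_le_of_lt (hB ?_) hJ⟩
    exact Finset.mem_coe.2 (Finset.mem_image.2 ⟨(x, y), by simp [hx, hy], rfl⟩)
  have hupper : ∀ x ∈ X, ∑ y ∈ X, G x y < 1 / 13 * X.card := by
    intro x hx
    have h1 : ∀ y ∈ X, G x y ≤ ∑ j ∈ Finset.range J, ∑ i : Bool,
        if y ∈ correlatedSet X Z j i x then Real.exp (2 * j + 2) else 0 := by
      intro y hy
      have hnn : ∀ j ∈ Finset.range J, 0 ≤ ∑ i : Bool,
          if y ∈ correlatedSet X Z j i x then Real.exp (2 * j + 2) else 0 := fun j _ =>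
        Finset.sum_nonneg fun i _ => by split_ifs <;> positivity
      by_cases hg : ∀ i, -4 ≤ Z i x y
      · simp only [hG, if_pos hg]
        set u := Real.sqrt (max (Z true x y) (Z false x y)) with hu
        have hu0 : 0 ≤ u := Real.sqrt_nonneg _
        have hfl := Nat.floor_le hu0
        have hmem : ⌊u⌋₊ ∈ Finset.range J := by
          rw [Finset.mem_range, Nat.floor_lt hu0]
          exact hJ x hx y hy
        refine le_trans ?_ (Finset.single_le_sum hnn hmem)
        obtain ⟨i, hi⟩ : ∃ i, max (Z true x y) (Z false x y) = Z i x y := by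
          rcases max_choice (Z true x y) (Z false x y) with h | h
          · exact ⟨true, h⟩
          · exact ⟨false, h⟩
        have hmem2 : y ∈ correlatedSet X Z ⌊u⌋₊ i x := by
          refine Finset.mem_filter.2 ⟨hy, hg, ?_⟩
          -- Level 0 imposes no lower bound beyond `-4`: the maximum may be negative, and its square
          -- root is then 0 by convention.
          rcases Nat.eq_zero_or_pos ⌊u⌋₊ with h | h
          · exact Or.inl h
          · right
            have h1 : (1 : ℝ) ≤ ⌊u⌋₊ := by exact_mod_cast h
            have h2 : 0 < Real.sqrt (max (Z true x y) (Z false x y)) := by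
              rw [← hu]; linarith
            have h3 := Real.sq_sqrt (Real.sqrt_pos.1 h2).le
            rw [← hi, ← h3, ← hu]
            gcongr
        refine le_trans ?_ (Finset.single_le_sum (fun i _ => ?_) (Finset.mem_univ i))
        · rw [if_pos hmem2]
          apply Real.exp_le_exp.2
          linarith [Nat.lt_floor_add_one u]
        · split_ifs <;> positivity
      · simp only [hG, if_neg hg]
        exact Finset.sum_nonneg hnn
    have h2 : ∑ y ∈ X, G x y ≤ ∑ j ∈ Finset.range J, ∑ i : Bool,
        ((correlatedSet X Z j i x).card : ℝ) * Real.exp (2 * j + 2) := by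
      refine (Finset.sum_le_sum h1).trans (le_of_eq ?_)
      rw [Finset.sum_comm]
      refine Finset.sum_congr rfl fun j _ => ?_
      rw [Finset.sum_comm]
      refine Finset.sum_congr rfl fun i _ => ?_
      rw [← Finset.sum_filter, Finset.sum_const, nsmul_eq_mul]
      congr 3
      ext y
      simp only [Finset.mem_filter, correlatedSet]
      tauto
    have h3 : ∀ j ∈ Finset.range J, ∑ i : Bool,
        ((correlatedSet X Z j i x).card : ℝ) * Real.exp (2 * j + 2) ≤
        (1 / 200 * X.card * Real.exp 2) * (1 / 2 : ℝ) ^ j := by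
      intro j _
      have h4 : Real.exp (-3 * j) * Real.exp (2 * j + 2) ≤ Real.exp 2 * (1 / 2 : ℝ) ^ j := by
        have h5 : Real.exp (-3 * j) * Real.exp (2 * j + 2) = Real.exp 2 * Real.exp (-1) ^ j := by
          rw [← Real.exp_nat_mul, ← Real.exp_add, ← Real.exp_add]
          ring_nf
        rw [h5]
        gcongr
        rw [Real.exp_neg, one_div]
        apply inv_anti₀ (by norm_num)
        linarith [Real.add_one_le_exp (1 : ℝ)]
      have h6 := hcon j true x hx
      have h7 := hcon j false x hx
      rw [Fintype.sum_bool, ← add_mul]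
      calc _ ≤ (1 / 400 * Real.exp (-3 * j) * X.card + 1 / 400 * Real.exp (-3 * j) * X.card) *
            Real.exp (2 * j + 2) := by gcongr
        _ = 1 / 200 * X.card * (Real.exp (-3 * j) * Real.exp (2 * j + 2)) := by ring
        _ ≤ 1 / 200 * X.card * (Real.exp 2 * (1 / 2 : ℝ) ^ j) := by gcongr
        _ = _ := by ring
    have h8 := h2.trans (Finset.sum_le_sum h3)
    rw [← Finset.mul_sum] at h8
    have h9 : ∑ j ∈ Finset.range J, (1 / 2 : ℝ) ^ j ≤ 2 := by
      refine (Summable.sum_le_tsum _ (fun _ _ => by positivity)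
        summable_geometric_two).trans (le_of_eq tsum_geometric_two)
    -- The constant 400 is chosen for this: `2 * 7.4 / 200 = 0.074 < 1/13`.
    have h10 : Real.exp 2 < 7.4 := by
      have := Real.exp_one_lt_d9
      have h11 : Real.exp 2 = Real.exp 1 ^ 2 := by rw [← Real.exp_nat_mul]; norm_num
      rw [h11]
      nlinarith [Real.exp_pos 1]
    calc _ ≤ _ := h8
      _ ≤ 1 / 200 * X.card * Real.exp 2 * 2 := by gcongr
      _ < 1 / 13 * X.card := by nlinarith
  have := Finset.sum_lt_sum_of_nonempty hX hupper
  rw [Finset.sum_const, nsmul_eq_mul] at this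
  nlinarith

/-! ### Codegrees as Gram kernels -/

open Classical in
/-- The neighbours of `x` in `Y`. -/
noncomputable def nbhd {V : Type} (H : SimpleGraph V) (x : V) (Y : Finset V) : Finset V :=
  Y.filter fun y => H.Adj x y

theorem mem_nbhd {V : Type} {H : SimpleGraph V} {x y : V} {Y : Finset V} :
    y ∈ nbhd H x Y ↔ y ∈ Y ∧ H.Adj x y := by
  simp [nbhd]

theorem nbhd_subset {V : Type} (H : SimpleGraph V) (x : V) (Y : Finset V) : nbhd H x Y ⊆ Y :=
  fun _ h => (mem_nbhd.1 h).1

/-- The feature functions of `codegreeKernel`: the neighbourhood of `x` in `Y`, weighted to have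
total weight `p * |Y|`, minus the constant `p`, and rescaled. -/
noncomputable def codegreeFeature {V : Type} (H : SimpleGraph V) (Y : Finset V) (p α : ℝ)
    (w x : V) : ℝ :=
  open Classical in
  ((if H.Adj x w then p * Y.card / (nbhd H x Y).card else 0) - p) *
    Real.sqrt (4 / (α * (p * Y.card)))

/-- The normalised excess of the weighted codegree of `x` and `y` in `Y`. -/
noncomputable def codegreeKernel {V : Type} (H : SimpleGraph V) (Y : Finset V) (p α : ℝ)
    (x y : V) : ℝ :=
  ∑ w ∈ Y, codegreeFeature H Y p α w x * codegreeFeature H Y p α w y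

theorem isGramKernel_codegreeKernel {V : Type} (H : SimpleGraph V) (Y : Finset V) (p α : ℝ) :
    IsGramKernel (codegreeKernel H Y p α) :=
  ⟨V, Y, codegreeFeature H Y p α, fun _ _ => rfl⟩

/-- Degrees are only bounded below, so each neighbourhood is reweighted to total mass `p * |Y|`. The
two cross terms and the constant term then combine exactly to `-p * (p * |Y|)`. -/
theorem codegreeKernel_eq {V : Type} {H : SimpleGraph V} {Y : Finset V} {p α : ℝ}
    (hα : 0 < α) (hp : 0 < p) (hY : Y.Nonempty) {x y : V} (hx : p * Y.card ≤ (nbhd H x Y).card)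
    (hy : p * Y.card ≤ (nbhd H y Y).card) :
    codegreeKernel H Y p α x y = 4 / (α * (p * Y.card)) *
      (p * Y.card / (nbhd H x Y).card * (p * Y.card / (nbhd H y Y).card) *
        (nbhd H y (nbhd H x Y)).card - p * (p * Y.card)) := by
  classical
  have hY' : (0 : ℝ) < Y.card := by exact_mod_cast hY.card_pos
  have hpY : 0 < p * Y.card := by positivity
  have hs : Real.sqrt (4 / (α * (p * Y.card))) * Real.sqrt (4 / (α * (p * Y.card))) =
      4 / (α * (p * Y.card)) := Real.mul_self_sqrt (by positivity)
  have hsum : ∀ (z : V) (c : ℝ), ∑ w ∈ Y, (if H.Adj z w then c else 0) = (nbhd H z Y).card * c := by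
    intro z c
    rw [← Finset.sum_filter, Finset.sum_const, nsmul_eq_mul, nbhd]
  have hsum2 : ∀ c : ℝ, ∑ w ∈ Y, (if H.Adj x w then (if H.Adj y w then c else 0) else 0) =
      (nbhd H y (nbhd H x Y)).card * c := by
    intro c
    rw [← Finset.sum_filter, ← Finset.sum_filter, Finset.sum_const, nsmul_eq_mul, nbhd, nbhd]
  set a := p * Y.card / (nbhd H x Y).card with ha
  set b := p * Y.card / (nbhd H y Y).card with hb
  have ha' : (nbhd H x Y).card * a = p * Y.card := by
    rw [ha]; exact mul_div_cancel₀ _ (by linarith)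
  have hb' : (nbhd H y Y).card * b = p * Y.card := by
    rw [hb]; exact mul_div_cancel₀ _ (by linarith)
  have hexp : ∀ w, codegreeFeature H Y p α w x * codegreeFeature H Y p α w y =
      4 / (α * (p * Y.card)) * ((if H.Adj x w then (if H.Adj y w then a * b else 0) else 0)
        - p * (if H.Adj x w then a else 0) - p * (if H.Adj y w then b else 0) + p * p) := by
    intro w
    unfold codegreeFeature
    rw [mul_mul_mul_comm, hs, ← ha, ← hb]
    split_ifs <;> ring
  unfold codegreeKernel
  simp only [hexp, ← Finset.mul_sum, Finset.sum_add_distrib, Finset.sum_sub_distrib, hsum, hsum2,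
    ha', hb', Finset.sum_const, nsmul_eq_mul]
  ring

/-- The weight at `y` is at most 1 and can be dropped; cancelling the weight at `x` turns the kernel
bound into a density inside the neighbourhood of `x`. -/
theorem le_card_of_le_codegreeKernel {V : Type} {H : SimpleGraph V} {Y : Finset V} {p α l : ℝ}
    (hα : 0 < α) (hp : 0 < p) (hY : Y.Nonempty) {x y : V} (hx : p * Y.card ≤ (nbhd H x Y).card)
    (hy : p * Y.card ≤ (nbhd H y Y).card) (h : 4 * l ≤ codegreeKernel H Y p α x y) :
    (p + l * α) * (nbhd H x Y).card ≤ (nbhd H y (nbhd H x Y)).card := by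
  have hY' : (0 : ℝ) < Y.card := by exact_mod_cast hY.card_pos
  have hpY : 0 < p * Y.card := by positivity
  rw [codegreeKernel_eq hα hp hY hx hy] at h
  set D : ℝ := ((nbhd H x Y).card : ℝ)
  set E : ℝ := ((nbhd H y Y).card : ℝ)
  set c : ℝ := ((nbhd H y (nbhd H x Y)).card : ℝ)
  set m := p * (Y.card : ℝ)
  have hD : 0 < D := by linarith
  have hc : 0 ≤ c := Nat.cast_nonneg _
  have hb : m / E ≤ 1 := div_le_one_of_le₀ hy (by linarith)
  have h1 : l * (α * m) ≤ m / D * (m / E) * c - p * m := by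
    rw [div_mul_eq_mul_div, le_div_iff₀ (by positivity)] at h
    linarith
  have h2 : m / D * (m / E) * c ≤ m / D * c := by
    have : 0 ≤ m / D * c := by positivity
    nlinarith
  have h3 : (p + l * α) * m ≤ m / D * c := by linarith
  rw [div_mul_eq_mul_div, le_div_iff₀ hD] at h3
  have h4 : m * ((p + l * α) * D) ≤ m * c := by linarith
  exact le_of_mul_le_mul_left h4 hpY

theorem exists_large_common_structure {V : Type} {X : Finset V} (hX : X.Nonempty)
    {H : Bool → SimpleGraph V} {Y : Bool → Finset V} (hY : ∀ i, (Y i).Nonempty) {p α : Bool → ℝ}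
    (hp : ∀ i, 0 < p i) (hα : ∀ i, 0 < α i)
    (hdeg : ∀ i, ∀ x ∈ X, p i * (Y i).card ≤ (nbhd (H i) x (Y i)).card) :
    ∃ (j : ℕ) (i : Bool), ∃ x ∈ X, ∃ X' ⊆ X, 1 / 400 * Real.exp (-3 * j) * X.card ≤ X'.card ∧
      (∀ y ∈ X', ∀ i, (p i - α i) * (nbhd (H i) x (Y i)).card ≤
        (nbhd (H i) y (nbhd (H i) x (Y i))).card) ∧
      (j = 0 ∨ ∀ y ∈ X', (p i + (j : ℝ) ^ 2 / 4 * α i) * (nbhd (H i) x (Y i)).card ≤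
        (nbhd (H i) y (nbhd (H i) x (Y i))).card) := by
  classical
  obtain ⟨j, i, x, hx, hcard⟩ := exists_large_correlatedSet hX
    (Z := fun i => codegreeKernel (H i) (Y i) (p i) (α i))
    fun i => isGramKernel_codegreeKernel _ _ _ _
  refine ⟨j, i, x, hx, _, Finset.filter_subset _ _, hcard, fun y hy i' => ?_, ?_⟩
  · obtain ⟨hyX, hy1, -⟩ := Finset.mem_filter.1 hy
    -- The thresholds `-4` and `j²` correspond to `l = -1` and `l = j²/4`.
    have := le_card_of_le_codegreeKernel (l := -1) (hα i') (hp i') (hY i') (hdeg i' x hx)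
      (hdeg i' y hyX) (by linarith [hy1 i'])
    linarith
  · rcases Nat.eq_zero_or_pos j with h0 | h0
    · exact Or.inl h0
    · refine Or.inr fun y hy => ?_
      obtain ⟨hyX, -, hy2⟩ := Finset.mem_filter.1 hy
      exact le_card_of_le_codegreeKernel (hα i) (hp i) (hY i) (hdeg i x hx) (hdeg i y hyX)
        (by linarith [hy2.resolve_left h0.ne'])

/-! ### The book algorithm -/

/-- A state of the book algorithm inside the vertex set `A`: for each colour `i` a clique `T i` of
size `τ i` completely joined to `X` and `Y i`, such that all vertices of `X` have density at least
`p i - δ + e i` to `Y i`. The counter `s i` is the number of density boosts in colour `i`. -/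
structure IsBookState {V : Type} (H : Bool → SimpleGraph V) (A : Finset V) (p : Bool → ℝ)
    (δ D K : ℝ) (t J : ℕ) (X : Finset V) (Y T : Bool → Finset V) (e : Bool → ℝ)
    (τ s : Bool → ℕ) : Prop where
  subset : X ⊆ A
  subset_pages : ∀ i, Y i ⊆ A
  subset_spine : ∀ i, T i ⊆ A
  isNClique : ∀ i, (H i).IsNClique (τ i) (T i)
  adj : ∀ i, ∀ v ∈ T i, ∀ x ∈ X, (H i).Adj v x
  adj_pages : ∀ i, ∀ v ∈ T i, ∀ y ∈ Y i, (H i).Adj v y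
  degree : ∀ i, ∀ x ∈ X, (p i - δ + e i) * (Y i).card ≤ (nbhd (H i) x (Y i)).card
  excess : ∀ i, δ * (1 - 1 / (t : ℝ)) ^ τ i * (1 + (J : ℝ) ^ 2 / (4 * t)) ^ s i ≤ e i
  card_pages : ∀ i, (p i - δ) ^ (τ i + s i) * A.card ≤ (Y i).card
  card : A.card * Real.exp (-K * (τ true + τ false) -
    D * (Real.log (e true / δ) + Real.log (e false / δ))) ≤ X.card

/-- The constraints on the parameters of the book algorithm. -/
structure BookParameters (p : Bool → ℝ) (δ D K : ℝ) (t J : ℕ) : Prop where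
  delta_pos : 0 < δ
  delta_lt : ∀ i, δ < p i
  two_le : 2 ≤ t
  one_le : 1 ≤ J
  sq_le : (J : ℝ) ^ 2 ≤ 4 * t
  le_D : 288 * t / (δ * J) ≤ D
  le_K : 3 * J + 8 + 2 * D / t ≤ K

theorem exp_neg_two_div_le {t : ℕ} (ht : 2 ≤ t) :
    Real.exp (-(2 / (t : ℝ))) ≤ 1 - 1 / (t : ℝ) := by
  have h2 : (2 : ℝ) ≤ t := by exact_mod_cast ht
  have h1 : 1 + 1 / ((t : ℝ) - 1) ≤ Real.exp (2 / t) := by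
    have h3 := Real.add_one_le_exp (1 / ((t : ℝ) - 1))
    have h4 : 1 / ((t : ℝ) - 1) ≤ 2 / t := by
      rw [div_le_div_iff₀ (by linarith) (by linarith)]
      linarith
    linarith [Real.exp_le_exp.2 h4]
  have h5 : 1 - 1 / (t : ℝ) = (1 + 1 / ((t : ℝ) - 1))⁻¹ := by
    have h6 : (t : ℝ) - 1 ≠ 0 := by linarith
    have h7 : (t : ℝ) ≠ 0 := by linarith
    have h8 : 1 + 1 / ((t : ℝ) - 1) = t / (t - 1) := by
      rw [eq_div_iff h6, add_mul, one_div_mul_cancel h6]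
      ring
    rw [h8, inv_div, sub_div, div_self h7]
  rw [Real.exp_neg, h5]
  apply inv_anti₀ _ h1
  have : (0 : ℝ) < t - 1 := by linarith
  positivity

theorem one_eighth_le_one_sub_inv_pow {t n : ℕ} (ht : 2 ≤ t) (hn : n ≤ t) :
    1 / 8 ≤ (1 - 1 / (t : ℝ)) ^ n := by
  have h2 : (2 : ℝ) ≤ t := by exact_mod_cast ht
  calc (1 : ℝ) / 8 ≤ Real.exp (-2) := by
        rw [Real.exp_neg, one_div]
        apply inv_anti₀ (Real.exp_pos _)
        have := Real.exp_one_lt_d9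
        have h11 : Real.exp 2 = Real.exp 1 ^ 2 := by rw [← Real.exp_nat_mul]; norm_num
        rw [h11]
        nlinarith [Real.exp_pos 1]
    _ = Real.exp (-(2 / (t : ℝ))) ^ t := by
        rw [← Real.exp_nat_mul]
        congr 1
        field_simp
    _ ≤ Real.exp (-(2 / (t : ℝ))) ^ n := by
        apply pow_le_pow_of_le_one (Real.exp_pos _).le _ hn
        rw [Real.exp_le_one_iff]
        have : (0 : ℝ) ≤ 2 / t := by positivity
        linarith
    _ ≤ _ := by
        gcongr
        exact exp_neg_two_div_le ht

theorem div_one_add_le_log {y : ℝ} (hy : 0 ≤ y) : y / (1 + y) ≤ Real.log (1 + y) := by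
  have := Real.one_sub_inv_le_log_of_pos (x := 1 + y) (by linarith)
  have h : 1 - (1 + y)⁻¹ = y / (1 + y) := by
    field_simp
    ring
  linarith

namespace BookParameters

variable {p : Bool → ℝ} {δ D K : ℝ} {t J : ℕ}

theorem t_pos (P : BookParameters p δ D K t J) : (0 : ℝ) < t := by
  have := P.two_le
  positivity

theorem one_le_J (P : BookParameters p δ D K t J) : (1 : ℝ) ≤ J := by exact_mod_cast P.one_le

theorem D_pos (P : BookParameters p δ D K t J) : 0 < D := by
  have := P.t_pos
  have := P.delta_pos
  have := P.one_le_J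
  exact lt_of_lt_of_le (by positivity) P.le_D

theorem K_pos (P : BookParameters p δ D K t J) : 0 < K := by
  have := P.t_pos
  have := P.D_pos
  have := P.one_le_J
  exact lt_of_lt_of_le (by positivity) P.le_K

theorem one_sub_inv_pos (P : BookParameters p δ D K t J) : 0 < 1 - 1 / (t : ℝ) :=
  (Real.exp_pos _).trans_le (exp_neg_two_div_le P.two_le)

end BookParameters

theorem card_le_card_nbhd_add_card_nbhd {V : Type} {H : Bool → SimpleGraph V}
    (hH : ∀ x y, x ≠ y → ∃ i, (H i).Adj x y) (A : Finset V) (x : V) :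
    A.card ≤ (nbhd (H true) x A).card + (nbhd (H false) x A).card + 1 := by
  classical
  have hsub : A ⊆ insert x (nbhd (H true) x A ∪ nbhd (H false) x A) := by
    intro z hz
    by_cases hxz : x = z
    · simp [hxz]
    · obtain ⟨b, hb⟩ := hH x z hxz
      cases b <;> simp [mem_nbhd, hz, hb]
  refine (Finset.card_le_card hsub).trans ((Finset.card_insert_le _ _).trans ?_)
  gcongr
  exact Finset.card_union_le _ _

namespace IsBookState

variable {V : Type} {H : Bool → SimpleGraph V} {A : Finset V} {p : Bool → ℝ} {δ D K : ℝ} {t J : ℕ}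
  {X : Finset V} {Y T : Bool → Finset V} {e : Bool → ℝ} {τ s : Bool → ℕ}

theorem excess_pos (P : BookParameters p δ D K t J) (h : IsBookState H A p δ D K t J X Y T e τ s)
    (i : Bool) : 0 < e i := by
  have := P.t_pos
  have := P.delta_pos
  have := P.one_sub_inv_pos
  exact lt_of_lt_of_le (by positivity) (h.excess i)

theorem le_excess (P : BookParameters p δ D K t J) (h : IsBookState H A p δ D K t J X Y T e τ s)
    (hτ : ∀ i, τ i ≤ t) (i : Bool) : δ / 8 * (1 + (J : ℝ) ^ 2 / (4 * t)) ^ s i ≤ e i := by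
  refine le_trans ?_ (h.excess i)
  have := P.t_pos
  have := P.delta_pos
  have h8 := one_eighth_le_one_sub_inv_pow P.two_le (hτ i)
  gcongr
  nlinarith

theorem pages_nonempty (P : BookParameters p δ D K t J) (hA : A.Nonempty)
    (h : IsBookState H A p δ D K t J X Y T e τ s) (i : Bool) : (Y i).Nonempty := by
  have h1 := h.card_pages i
  have h2 : (0 : ℝ) < A.card := by exact_mod_cast hA.card_pos
  have h3 : 0 < p i - δ := by linarith [P.delta_lt i]
  have h4 : (0 : ℝ) < (Y i).card := lt_of_lt_of_le (by positivity) h1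
  exact Finset.card_pos.1 (by exact_mod_cast h4)

theorem excess_le_one (P : BookParameters p δ D K t J) (hA : A.Nonempty) (hX : X.Nonempty)
    (h : IsBookState H A p δ D K t J X Y T e τ s) (i : Bool) : e i ≤ 1 := by
  obtain ⟨x, hx⟩ := hX
  have h1 := h.degree i x hx
  have h2 : (0 : ℝ) < (Y i).card := by exact_mod_cast (h.pages_nonempty P hA i).card_pos
  have h3 : ((nbhd (H i) x (Y i)).card : ℝ) ≤ 1 * (Y i).card := by
    rw [one_mul]
    exact_mod_cast Finset.card_le_card (nbhd_subset _ _ _)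
  have h4 := le_of_mul_le_mul_right (h1.trans h3) h2
  linarith [P.delta_lt i]

theorem nonempty (hA : A.Nonempty)
    (h : IsBookState H A p δ D K t J X Y T e τ s) : X.Nonempty := by
  have h2 : (0 : ℝ) < A.card := by exact_mod_cast hA.card_pos
  have : (0 : ℝ) < X.card := lt_of_lt_of_le (by positivity) h.card
  exact Finset.card_pos.1 (by exact_mod_cast this)

/-- Each boost multiplies the lower bound on the excess by `1 + J²/(4t)`, colour steps cost at most
a factor 8 in total, and the excess never exceeds 1. -/
theorem boosts_le (P : BookParameters p δ D K t J) (hA : A.Nonempty)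
    (h : IsBookState H A p δ D K t J X Y T e τ s) (hτ : ∀ i, τ i ≤ t) (i : Bool) :
    (s i : ℝ) ≤ 8 * t * Real.log (8 / δ) / J ^ 2 := by
  have ht := P.t_pos
  have hδ := P.delta_pos
  have hJ := P.one_le_J
  have h1 := (h.le_excess P hτ i).trans (h.excess_le_one P hA (h.nonempty hA) i)
  set y := (J : ℝ) ^ 2 / (4 * t) with hy
  have hy0 : 0 < y := by positivity
  have hy1 : y ≤ 1 := (div_le_one (by positivity)).2 P.sq_le
  have h2 : (1 + y) ^ s i ≤ 8 / δ := by
    rw [le_div_iff₀ hδ]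
    linarith
  have h3 := Real.log_le_log (by positivity) h2
  rw [Real.log_pow] at h3
  have h4 : y / 2 ≤ Real.log (1 + y) := by
    refine le_trans ?_ (div_one_add_le_log hy0.le)
    gcongr
    linarith
  have h5 : (s i : ℝ) * (y / 2) ≤ Real.log (8 / δ) := le_trans (by gcongr) h3
  rw [le_div_iff₀ (by positivity)]
  have h6 : (s i : ℝ) * J ^ 2 = 8 * t * (s i * (y / 2)) := by
    rw [hy]
    field_simp
    ring
  rw [h6]
  gcongr

theorem le_card (P : BookParameters p δ D K t J) (hA : A.Nonempty)
    (h : IsBookState H A p δ D K t J X Y T e τ s) (hτ : ∀ i, τ i ≤ t) :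
    A.card * Real.exp (-(2 * t * K) - 2 * D * Real.log (1 / δ)) ≤ X.card := by
  refine le_trans ?_ h.card
  have hlog : ∀ i, Real.log (e i / δ) ≤ Real.log (1 / δ) := fun i =>
    Real.log_le_log (div_pos (h.excess_pos P i) P.delta_pos)
      (div_le_div_of_nonneg_right (h.excess_le_one P hA (h.nonempty hA) i)
        P.delta_pos.le)
  have h1 : (τ true : ℝ) ≤ t := by exact_mod_cast hτ true
  have h2 : (τ false : ℝ) ≤ t := by exact_mod_cast hτ false
  have h3 := hlog true
  have h4 := hlog false
  have hK := P.K_pos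
  have hD := P.D_pos
  refine mul_le_mul_of_nonneg_left (Real.exp_le_exp.2 ?_) (Nat.cast_nonneg _)
  nlinarith [mul_le_mul_of_nonneg_left h1 hK.le, mul_le_mul_of_nonneg_left h2 hK.le,
    mul_le_mul_of_nonneg_left h3 hD.le, mul_le_mul_of_nonneg_left h4 hD.le]

/-- The excess falls by the factor `1 - 1/t`. In `K`, the part `3J + 8` pays for the shrinking of
`X`, and `2D/t` for the drop of `log (e i)` in the potential `card`. -/
theorem color_step (P : BookParameters p δ D K t J)
    (h : IsBookState H A p δ D K t J X Y T e τ s) {x : V} (hx : x ∈ X) {X' : Finset V}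
    (hX' : X' ⊆ X) {i : Bool} (hadj : ∀ y ∈ X', (H i).Adj x y)
    (hcard : X.card * Real.exp (-(3 * J + 8)) ≤ X'.card)
    (hdeg : ∀ y ∈ X', (p i - δ + e i - e i / t) * (nbhd (H i) x (Y i)).card ≤
        (nbhd (H i) y (nbhd (H i) x (Y i))).card) :
    ∃ Y' T' e', IsBookState H A p δ D K t J X' Y' T' e' (Function.update τ i (τ i + 1)) s := by
  classical
  have hpos := h.excess_pos P
  refine ⟨Function.update Y i (nbhd (H i) x (Y i)), Function.update T i (insert x (T i)),
    Function.update e i (e i * (1 - 1 / t)), ?_⟩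
  constructor
  · exact hX'.trans h.subset
  · intro b
    by_cases hb : b = i
    · subst hb
      simpa using (nbhd_subset _ _ _).trans (h.subset_pages b)
    · simpa [hb] using h.subset_pages b
  · intro b
    by_cases hb : b = i
    · subst hb
      simpa using Finset.insert_subset (h.subset hx) (h.subset_spine b)
    · simpa [hb] using h.subset_spine b
  · intro b
    by_cases hb : b = i
    · subst hb
      simpa using (h.isNClique b).insert fun v hv => (h.adj b v hv x hx).symm
    · simpa [hb] using h.isNClique b
  · intro b v hv y hy
    by_cases hb : b = i
    · subst hb
      simp only [Function.update_self, Finset.mem_insert] at hv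
      rcases hv with rfl | hv
      · exact hadj y hy
      · exact h.adj b v hv y (hX' hy)
    · simp only [Function.update_of_ne hb] at hv
      exact h.adj b v hv y (hX' hy)
  · intro b v hv y hy
    by_cases hb : b = i
    · subst hb
      simp only [Function.update_self, Finset.mem_insert] at hv hy
      rcases hv with rfl | hv
      · exact (mem_nbhd.1 hy).2
      · exact h.adj_pages b v hv y (mem_nbhd.1 hy).1
    · simp only [Function.update_of_ne hb] at hv hy
      exact h.adj_pages b v hv y hy
  · intro b y hy
    by_cases hb : b = i
    · subst hb
      simp only [Function.update_self]
      convert hdeg y hy using 2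
      ring
    · simpa only [Function.update_of_ne hb] using h.degree b y (hX' hy)
  · intro b
    by_cases hb : b = i
    · subst hb
      simp only [Function.update_self]
      have := mul_le_mul_of_nonneg_right (h.excess b) P.one_sub_inv_pos.le
      refine le_trans (le_of_eq ?_) this
      ring
    · simpa only [Function.update_of_ne hb] using h.excess b
  · intro b
    by_cases hb : b = i
    · subst hb
      simp only [Function.update_self]
      have hp : 0 < p b - δ := by linarith [P.delta_lt b]
      refine le_trans ?_ (h.degree b x hx)
      have h1 := h.card_pages b
      calc _ = (p b - δ) * ((p b - δ) ^ (τ b + s b) * A.card) := by ring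
        _ ≤ (p b - δ) * (Y b).card := by gcongr
        _ ≤ _ := by gcongr; linarith [hpos b]
    · simpa only [Function.update_of_ne hb] using h.card_pages b
  · refine le_trans ?_ hcard
    refine le_trans ?_ (mul_le_mul_of_nonneg_right h.card (Real.exp_pos _).le)
    rw [mul_assoc, ← Real.exp_add]
    gcongr
    have hlog : Real.log (e i * (1 - 1 / t) / δ) = Real.log (e i / δ) + Real.log (1 - 1 / t) := by
      rw [mul_div_right_comm, Real.log_mul (div_pos (hpos i) P.delta_pos).ne'
        P.one_sub_inv_pos.ne']
    have hlog2 : -(2 / (t : ℝ)) ≤ Real.log (1 - 1 / t) :=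
      (Real.le_log_iff_exp_le P.one_sub_inv_pos).2 (exp_neg_two_div_le P.two_le)
    have hK := P.le_K
    have hD := mul_le_mul_of_nonneg_left hlog2 P.D_pos.le
    have hD2 : 2 * D / t = D * (2 / t) := by ring
    cases i <;> simp only [Function.update_self, ne_eq, reduceCtorEq, not_false_eq_true,
      Function.update_of_ne, hlog, Nat.cast_add, Nat.cast_one] <;> linarith

/-- Only the pages of colour `i` shrink, to the neighbourhood of `x`. The spine is unchanged since
`X'` need not lie in that neighbourhood. The growth of `log (e i)`, weighted by `D`, pays for the
loss in `X`. -/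
theorem boost_step (P : BookParameters p δ D K t J) (hA : A.Nonempty)
    (h : IsBookState H A p δ D K t J X Y T e τ s) (hτ : ∀ i, τ i ≤ t) {x : V} (hx : x ∈ X)
    {X' : Finset V} (hX' : X' ⊆ X) {i : Bool} {j : ℕ} (hj : J ≤ j)
    (hcard : 1 / 400 * Real.exp (-3 * j) * X.card ≤ X'.card)
    (hdeg : ∀ y ∈ X', (p i - δ + e i + (j : ℝ) ^ 2 / 4 * (e i / t)) *
      (nbhd (H i) x (Y i)).card ≤ (nbhd (H i) y (nbhd (H i) x (Y i))).card) :
    ∃ Y' e', IsBookState H A p δ D K t J X' Y' T e' τ (Function.update s i (s i + 1)) := by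
  classical
  have hpos := h.excess_pos P
  have ht := P.t_pos
  have hδ := P.delta_pos
  have hJ := P.one_le_J
  have hp : 0 < p i - δ := by linarith [P.delta_lt i]
  have hjJ : (J : ℝ) ≤ j := by exact_mod_cast hj
  set y := (j : ℝ) ^ 2 / (4 * t) with hy
  have hj0 : (0 : ℝ) < j := by linarith
  have hy0 : 0 < y := by positivity
  have hY' : (p i - δ) ^ (τ i + (s i + 1)) * A.card ≤ (nbhd (H i) x (Y i)).card := by
    refine le_trans ?_ (h.degree i x hx)
    have h1 := h.card_pages i
    calc _ = (p i - δ) * ((p i - δ) ^ (τ i + s i) * A.card) := by ring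
      _ ≤ (p i - δ) * (Y i).card := by gcongr
      _ ≤ _ := by gcongr; linarith [hpos i]
  have he' : e i * (1 + y) ≤ 1 := by
    have h0 : (0 : ℝ) < X'.card := lt_of_lt_of_le
      (by have : (0 : ℝ) < X.card := by exact_mod_cast Finset.card_pos.2 ⟨x, hx⟩
          positivity) hcard
    obtain ⟨z, hz⟩ : X'.Nonempty := Finset.card_pos.1 (by exact_mod_cast h0)
    have h1 := hdeg z hz
    have h2 : (0 : ℝ) < (nbhd (H i) x (Y i)).card := lt_of_lt_of_le
      (by have : (0 : ℝ) < A.card := by exact_mod_cast hA.card_pos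
          positivity) hY'
    have h3 : ((nbhd (H i) z (nbhd (H i) x (Y i))).card : ℝ) ≤
        1 * (nbhd (H i) x (Y i)).card := by
      rw [one_mul]
      exact_mod_cast Finset.card_le_card (nbhd_subset _ _ _)
    have h4 := le_of_mul_le_mul_right (h1.trans h3) h2
    have h5 : (j : ℝ) ^ 2 / 4 * (e i / t) = e i * y := by
      rw [hy]; field_simp
    rw [h5] at h4
    linarith
  -- Since `δ/8 ≤ e i` and the new excess is at most 1, `1 + y ≤ 8/δ`, so `log (1 + y) ≥ yδ/8`. The
  -- constant 288 in `le_D` turns this into a gain of `9j · (j/J) ≥ 9j`.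
  have hloss : 6 + 3 * (j : ℝ) ≤ D * Real.log (1 + y) := by
    have h1 : δ / 8 ≤ e i := by
      refine le_trans ?_ (h.le_excess P hτ i)
      have : 1 ≤ (1 + (J : ℝ) ^ 2 / (4 * t)) ^ s i := one_le_pow₀ (by
        have : 0 ≤ (J : ℝ) ^ 2 / (4 * t) := by positivity
        linarith)
      nlinarith
    have h2 : 1 + y ≤ 8 / δ := by
      rw [le_div_iff₀ hδ]
      nlinarith
    have h3 : y * (δ / 8) ≤ Real.log (1 + y) := by
      refine le_trans ?_ (div_one_add_le_log hy0.le)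
      rw [div_eq_mul_inv y]
      refine mul_le_mul_of_nonneg_left ?_ hy0.le
      rw [← inv_div]
      exact inv_anti₀ (by positivity) h2
    calc 6 + 3 * (j : ℝ) ≤ 9 * j := by linarith
      _ ≤ 288 * t / (δ * J) * (y * (δ / 8)) := by
          have : 288 * t / (δ * J) * (y * (δ / 8)) = 9 * j * (j / J) := by
            rw [hy]; field_simp; ring
          rw [this]
          have : 1 ≤ (j : ℝ) / J := (one_le_div (by linarith)).2 hjJ
          nlinarith
      _ ≤ D * Real.log (1 + y) := by
          have := P.le_D
          have := P.D_pos
          gcongr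
  refine ⟨Function.update Y i (nbhd (H i) x (Y i)), Function.update e i (e i * (1 + y)), ?_⟩
  constructor
  · exact hX'.trans h.subset
  · intro b
    by_cases hb : b = i
    · subst hb
      simpa using (nbhd_subset _ _ _).trans (h.subset_pages b)
    · simpa [hb] using h.subset_pages b
  · exact h.subset_spine
  · exact h.isNClique
  · exact fun b v hv z hz => h.adj b v hv z (hX' hz)
  · intro b v hv z hz
    by_cases hb : b = i
    · subst hb
      simp only [Function.update_self] at hz
      exact h.adj_pages b v hv z (mem_nbhd.1 hz).1
    · simp only [Function.update_of_ne hb] at hz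
      exact h.adj_pages b v hv z hz
  · intro b z hz
    by_cases hb : b = i
    · subst hb
      simp only [Function.update_self]
      convert hdeg z hz using 2
      rw [hy]
      field_simp
      ring
    · simpa only [Function.update_of_ne hb] using h.degree b z (hX' hz)
  · intro b
    by_cases hb : b = i
    · subst hb
      simp only [Function.update_self]
      rw [pow_succ _ (s b), ← mul_assoc]
      have h1 : (J : ℝ) ^ 2 / (4 * t) ≤ y := by
        rw [hy]
        gcongr
      have := h.excess b
      have := (hpos b).le
      gcongr
    · simpa only [Function.update_of_ne hb] using h.excess b
  · intro b
    by_cases hb : b = i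
    · subst hb
      simpa only [Function.update_self] using hY'
    · simpa only [Function.update_of_ne hb] using h.card_pages b
  · refine le_trans ?_ hcard
    rw [mul_comm]
    have h6 : Real.exp (-(6 + 3 * j)) ≤ 1 / 400 * Real.exp (-3 * j) := by
      rw [neg_add, Real.exp_add, neg_mul]
      gcongr
      rw [Real.exp_neg, one_div]
      apply inv_anti₀ (by norm_num)
      have h11 : Real.exp 6 = Real.exp 1 ^ 6 := by rw [← Real.exp_nat_mul]; norm_num
      rw [h11]
      have := Real.exp_one_gt_d9
      calc (400 : ℝ) ≤ 2.718 ^ 6 := by norm_num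
        _ ≤ _ := by gcongr; linarith
    have hlog : Real.log (e i * (1 + y) / δ) = Real.log (e i / δ) + Real.log (1 + y) := by
      rw [mul_div_right_comm, Real.log_mul (div_pos (hpos i) hδ).ne' (by positivity)]
    calc _ ≤ Real.exp (-(6 + 3 * j)) * (A.card * Real.exp (-K * (τ true + τ false) -
          D * (Real.log (e true / δ) + Real.log (e false / δ)))) := by
          rw [mul_left_comm, ← Real.exp_add, mul_comm]
          gcongr
          cases i <;> simp only [Function.update_self, ne_eq, reduceCtorEq, not_false_eq_true,
            Function.update_of_ne, hlog] <;> linarith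
      _ ≤ _ := mul_le_mul h6 h.card (by positivity) (by positivity)

/-- The geometric lemma is applied with `α i = e i / t`. Level `j ≥ J` gives a boost; a lower level
keeps `X'` large enough for a colour step. -/
theorem exists_next (P : BookParameters p δ D K t J) (hH : ∀ x y, x ≠ y → ∃ i, (H i).Adj x y)
    (hbig : Real.exp (3 * J + 8) ≤
      A.card * Real.exp (-(2 * t * K) - 2 * D * Real.log (1 / δ)))
    (h : IsBookState H A p δ D K t J X Y T e τ s) (hτ : ∀ i, τ i ≤ t) :
    ∃ X' Y' T' e' i, IsBookState H A p δ D K t J X' Y' T' e' (Function.update τ i (τ i + 1)) s ∨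
      IsBookState H A p δ D K t J X' Y' T' e' τ (Function.update s i (s i + 1)) := by
  classical
  have hA : A.Nonempty := by
    rw [Finset.nonempty_iff_ne_empty]
    rintro rfl
    simp only [Finset.card_empty, Nat.cast_zero, zero_mul] at hbig
    exact absurd hbig (not_le.2 (Real.exp_pos _))
  have hpos := h.excess_pos P
  have ht := P.t_pos
  have hXcard := hbig.trans (h.le_card P hA hτ)
  obtain ⟨j, i, x, hx, X', hX', hcard, hdeg, hboost⟩ := exists_large_common_structure
    (h.nonempty hA) (H := H) (p := fun i => p i - δ + e i) (α := fun i => e i / t)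
    (h.pages_nonempty P hA) (fun i => by have := P.delta_lt i; have := hpos i; linarith)
    (fun i => div_pos (hpos i) ht) h.degree
  rcases le_or_gt J j with hj | hj
  · have hj0 : j ≠ 0 := by have := P.one_le; omega
    obtain ⟨Y', e', h'⟩ := h.boost_step P hA hτ hx hX' hj hcard (hboost.resolve_left hj0)
    exact ⟨X', Y', T, e', i, Or.inr h'⟩
  · have hjJ : (j : ℝ) ≤ J := by exact_mod_cast hj.le
    have h8 : (1200 : ℝ) ≤ Real.exp 8 := by
      have h11 : Real.exp 8 = Real.exp 1 ^ 8 := by rw [← Real.exp_nat_mul]; norm_num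
      rw [h11]
      have := Real.exp_one_gt_d9
      calc (1200 : ℝ) ≤ 2.718 ^ 8 := by norm_num
        _ ≤ _ := by gcongr; linarith
    have h1 : 1 / 400 * Real.exp (-3 * J) * X.card ≤ X'.card := by
      refine le_trans ?_ hcard
      gcongr ?_ * _
      gcongr 1 / 400 * ?_
      apply Real.exp_le_exp.2
      linarith
    -- With at least three vertices, one colour neighbourhood has a third of `X'` even after
    -- discarding `x`.
    have h3 : (3 : ℝ) ≤ X'.card := by
      refine le_trans ?_ h1
      calc (3 : ℝ) ≤ 1 / 400 * Real.exp 8 := by linarith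
        _ = 1 / 400 * Real.exp (-3 * J) * Real.exp (3 * J + 8) := by
            rw [mul_assoc, ← Real.exp_add]; ring_nf
        _ ≤ _ := by gcongr
    have hsplit := card_le_card_nbhd_add_card_nbhd hH X' x
    obtain ⟨b, hb⟩ : ∃ b, (X'.card : ℝ) / 3 ≤ (nbhd (H b) x X').card := by
      by_contra! hcon
      have h4 := hcon true
      have h5 := hcon false
      have h6 : (X'.card : ℝ) ≤ (nbhd (H true) x X').card + (nbhd (H false) x X').card + 1 := by
        exact_mod_cast hsplit
      linarith
    have hcard' : X.card * Real.exp (-(3 * J + 8)) ≤ (nbhd (H b) x X').card := by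
      refine le_trans ?_ hb
      have h9 : Real.exp (-(3 * J + 8)) ≤ 1 / 1200 * Real.exp (-3 * J) := by
        rw [neg_add, Real.exp_add, neg_mul, mul_comm]
        gcongr
        rw [Real.exp_neg, one_div]
        exact inv_anti₀ (by norm_num) h8
      have := mul_le_mul_of_nonneg_right h9 (Nat.cast_nonneg (α := ℝ) X.card)
      linarith
    obtain ⟨Y', T', e', h'⟩ := h.color_step P hx ((nbhd_subset (H b) x X').trans hX') (i := b)
      (fun y hy => (mem_nbhd.1 hy).2) hcard' (fun y hy => hdeg y (mem_nbhd.1 hy).1 b)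
    exact ⟨_, Y', T', e', b, Or.inl h'⟩

end IsBookState

theorem exists_book {V : Type} {H : Bool → SimpleGraph V} {A : Finset V} {p : Bool → ℝ}
    {δ D K : ℝ} {t J : ℕ} (P : BookParameters p δ D K t J)
    (hH : ∀ x y, x ≠ y → ∃ i, (H i).Adj x y)
    (hbig : Real.exp (3 * J + 8) ≤
      A.card * Real.exp (-(2 * t * K) - 2 * D * Real.log (1 / δ)))
    (hdeg : ∀ i, ∀ x ∈ A, p i * A.card ≤ (nbhd (H i) x A).card) :
    ∃ (i : Bool) (T Y : Finset V) (s : ℕ), T ⊆ A ∧ Y ⊆ A ∧ (H i).IsNClique t T ∧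
      (∀ v ∈ T, ∀ y ∈ Y, (H i).Adj v y) ∧ (p i - δ) ^ (t + s) * A.card ≤ Y.card ∧
      (s : ℝ) ≤ 8 * t * Real.log (8 / δ) / J ^ 2 := by
  have hA : A.Nonempty := by
    rw [Finset.nonempty_iff_ne_empty]
    rintro rfl
    simp only [Finset.card_empty, Nat.cast_zero, zero_mul] at hbig
    exact absurd hbig (not_le.2 (Real.exp_pos _))
  by_contra! hcon
  -- If no book is ever completed, the algorithm runs for any number of steps, although both kinds
  -- of step are bounded in number.
  have main : ∀ n : ℕ, ∃ X Y T e τ s, IsBookState H A p δ D K t J X Y T e τ s ∧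
      (∀ i, τ i < t) ∧ τ true + τ false + (s true + s false) = n := by
    intro n
    induction n with
    | zero =>
      refine ⟨A, fun _ => A, fun _ => ∅, fun _ => δ, fun _ => 0, fun _ => 0, ?_, ?_, rfl⟩
      · constructor
        · exact subset_rfl
        · exact fun _ => subset_rfl
        · simp
        · simp
        · simp
        · simp
        · simpa using hdeg
        · simp
        · simp
        · simp [P.delta_pos.ne']
      · exact fun i => by have := P.two_le; show 0 < t; omega
    | succ n ih =>
      obtain ⟨X, Y, T, e, τ, s, h, hτ, hn⟩ := ih
      obtain ⟨X', Y', T', e', i, h' | h'⟩ := h.exists_next P hH hbig fun i => (hτ i).le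
      · have hle : ∀ b, Function.update τ i (τ i + 1) b ≤ t := by
          intro b
          by_cases hb : b = i
          · subst hb
            simpa using hτ b
          · simpa [hb] using (hτ b).le
        refine ⟨X', Y', T', e', _, s, h', fun b => lt_of_le_of_ne (hle b) fun heq => ?_, ?_⟩
        · have hc := h'.isNClique b
          have hp := h'.card_pages b
          rw [heq] at hc hp
          exact absurd (h'.boosts_le P hA hle b) (not_le.2 (hcon b (T' b) (Y' b) (s b)
            (h'.subset_spine b) (h'.subset_pages b) hc (h'.adj_pages b) hp))
        · cases i <;> simp <;> omega
      · refine ⟨X', Y', T', e', τ, _, h', hτ, ?_⟩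
        cases i <;> simp <;> omega
  obtain ⟨S, hS⟩ := exists_nat_gt (8 * t * Real.log (8 / δ) / J ^ 2 : ℝ)
  obtain ⟨X, Y, T, e, τ, s, h, hτ, hn⟩ := main (2 * t + 2 * S)
  have hs : ∀ i, s i < S := fun i => by
    have := (h.boosts_le P hA (fun i => (hτ i).le) i).trans_lt hS
    exact_mod_cast this
  have := hτ true
  have := hτ false
  have := hs true
  have := hs false
  omega

/-! ### Binomial coefficients and the Erdős–Szekeres bound -/

/-- The binomial coefficient with parts `k true` and `k false`. -/
def binom (k : Bool → ℕ) : ℕ := (k true + k false).choose (k true)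

/-- `A` contains a clique of size `k i + 1` in `H i`, for some colour `i`. -/
def HasMonoClique {V : Type} (H : Bool → SimpleGraph V) (A : Finset V) (k : Bool → ℕ) : Prop :=
  ∃ i, ∃ s ⊆ A, (H i).IsNClique (k i + 1) s

theorem binom_pos (k : Bool → ℕ) : 0 < binom k := Nat.choose_pos (Nat.le_add_right _ _)

theorem binom_eq (k : Bool → ℕ) (i : Bool) : binom k = (k i + k !i).choose (k i) := by
  cases i
  · rw [binom, Nat.choose_symm_add, add_comm, Bool.not_false]
  · rfl

theorem sum_eq (k : Bool → ℕ) (i : Bool) : k true + k false = k i + k !i := by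
  cases i <;> simp [add_comm]

theorem binom_update_mul (k : Bool → ℕ) (i : Bool) {n : ℕ} (h : k i = n + 1) :
    binom (Function.update k i n) * (k true + k false) = binom k * k i := by
  rw [binom_eq k i, binom_eq _ i, sum_eq k i, Function.update_self,
    Function.update_of_ne (by cases i <;> simp), h, show n + 1 + k (!i) = n + k (!i) + 1 by ring,
    mul_comm, Nat.add_one_mul_choose_eq]

theorem binom_update_add (k : Bool → ℕ) (h : ∀ i, k i ≠ 0) :
    binom (Function.update k true (k true - 1)) + binom (Function.update k false (k false - 1)) =
      binom k := by
  obtain ⟨a, ha⟩ := Nat.exists_eq_succ_of_ne_zero (h true)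
  obtain ⟨b, hb⟩ := Nat.exists_eq_succ_of_ne_zero (h false)
  simp only [binom, Function.update_self, ne_eq, reduceCtorEq, not_false_eq_true,
    Function.update_of_ne, ha, hb, Nat.succ_eq_add_one, Nat.add_sub_cancel]
  rw [show a + 1 + (b + 1) = (a + (b + 1)) + 1 by ring, Nat.choose_succ_succ,
    show a + 1 + b = a + (b + 1) by ring]

theorem two_pow_le_binom {k : Bool → ℕ} {m : ℕ} (h : ∀ i, m ≤ k i) : 2 ^ m ≤ binom k := by
  have h1 : (m + m).choose m ≤ binom k := by
    calc (m + m).choose m ≤ (m + k false).choose m := Nat.choose_le_choose _ (by linarith [h false])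
      _ = (m + k false).choose (k false) := Nat.choose_symm_add
      _ ≤ (k true + k false).choose (k false) := Nat.choose_le_choose _ (by linarith [h true])
      _ = binom k := Nat.choose_symm_add.symm
  refine le_trans ?_ h1
  rcases Nat.eq_zero_or_pos m with rfl | hm
  · simp
  · have h2 := Nat.four_pow_le_two_mul_self_mul_centralBinom m hm
    rw [Nat.centralBinom, two_mul] at h2
    have h3 : m + m ≤ 2 ^ m := by
      obtain ⟨n, rfl⟩ := Nat.exists_eq_succ_of_ne_zero hm.ne'
      have := Nat.lt_two_pow_self (n := n)
      rw [Nat.pow_succ]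
      omega
    have h4 : 2 ^ m * 2 ^ m ≤ 2 ^ m * (m + m).choose m := by
      rw [← mul_pow]
      exact h2.trans (Nat.mul_le_mul_right _ h3)
    exact Nat.le_of_mul_le_mul_left h4 (by positivity)

theorem exp_half_mul_le_binom {k : Bool → ℕ} {r : ℝ} (h : ∀ i, r ≤ k i) :
    Real.exp (r / 2) ≤ binom k := by
  have h1 : (2 : ℝ) ^ min (k true) (k false) ≤ binom k := by
    exact_mod_cast two_pow_le_binom (k := k) (m := min (k true) (k false))
      (Bool.rec (min_le_right _ _) (min_le_left _ _))
  refine le_trans ?_ h1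
  have h2 : r ≤ (min (k true) (k false) : ℕ) := by
    rcases min_choice (k true) (k false) with h' | h' <;> rw [h'] <;> exact h _
  have h3 : Real.exp (1 / 2) ≤ 2 := by
    rw [← Real.le_log_iff_exp_le (by norm_num)]
    linarith [Real.log_two_gt_d9]
  calc Real.exp (r / 2) ≤ Real.exp ((min (k true) (k false) : ℕ) * (1 / 2)) := by
        apply Real.exp_le_exp.2
        linarith
    _ = Real.exp (1 / 2) ^ min (k true) (k false) := Real.exp_nat_mul _ _
    _ ≤ _ := by gcongr

/-- The `u`-th successive ratio is `(k i - u) / (N - u)`, below `k i / N` by at least the factor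
`exp (-uμ/N)`. Multiplying over `u < t` gives the quadratic exponent, which is the gain of a book
over single steps. -/
theorem binom_update_sub_le {k : Bool → ℕ} {i : Bool} {μ : ℝ} (hμ : 0 ≤ μ)
    (h : μ * (k true + k false) ≤ k !i) {t : ℕ} (ht : t ≤ k i) :
    (binom (Function.update k i (k i - t)) : ℝ) ≤
      binom k * ((k i / (k true + k false : ℝ)) ^ t *
        Real.exp (-(μ * (t * (t - 1)) / (2 * (k true + k false))))) := by
  have hsum : (k true : ℝ) + k false = k i + k !i := by exact_mod_cast sum_eq k i
  rw [hsum] at h ⊢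
  induction t with
  | zero => simp
  | succ t ih =>
    have ih := ih (by omega)
    set k' := Function.update k i (k i - t) with hk'
    have h1 : Function.update k i (k i - (t + 1)) = Function.update k' i (k i - (t + 1)) := by
      rw [hk', Function.update_idem]
    have hi : k' i = k i - t := by simp [hk']
    have hni : k' (!i) = k !i := by rw [hk', Function.update_of_ne (by cases i <;> simp)]
    have h2 := binom_update_mul k' i (n := k i - (t + 1)) (by rw [hi]; omega)
    rw [sum_eq k' i, hi, hni, ← h1] at h2
    have htk : (t : ℝ) + 1 ≤ k i := by exact_mod_cast ht
    have h3 : (binom (Function.update k i (k i - (t + 1))) : ℝ) * (k i - t + k !i) =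
        binom k' * (k i - t) := by
      have : ((k i - t : ℕ) : ℝ) = k i - t := by push_cast [show t ≤ k i by omega]; ring
      rw [← this]
      exact_mod_cast h2
    set x : ℝ := (k i : ℝ)
    set z : ℝ := (k (!i) : ℝ)
    have ht0 : (0 : ℝ) ≤ t := Nat.cast_nonneg t
    have hz : (0 : ℝ) ≤ z := Nat.cast_nonneg _
    have hN : 0 < x + z := by linarith
    have hNt : 0 < x - t + z := by linarith
    have h4 : (x - t) / (x - t + z) ≤ x / (x + z) * Real.exp (-(t * μ / (x + z))) := by
      have h5 : 1 - t * μ / (x + z) ≤ Real.exp (-(t * μ / (x + z))) := by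
        linarith [Real.add_one_le_exp (-(t * μ / (x + z)))]
      have hx : 0 ≤ x / (x + z) := div_nonneg (by linarith) hN.le
      refine le_trans ?_ (mul_le_mul_of_nonneg_left h5 hx)
      rw [div_le_iff₀ hNt, ← sub_nonneg]
      have h6 : x / (x + z) * (1 - t * μ / (x + z)) * (x - t + z) - (x - t) =
          t * ((z * (x + z) - x * μ * (x - t + z)) / (x + z) ^ 2) := by
        field_simp
        ring
      rw [h6]
      refine mul_nonneg ht0 (div_nonneg ?_ (by positivity))
      have h7 : x * μ * (x - t + z) ≤ x * μ * (x + z) := by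
        have : 0 ≤ x * μ := mul_nonneg (by linarith) hμ
        nlinarith
      have h8 : x * (μ * (x + z)) ≤ x * z := mul_le_mul_of_nonneg_left h (by linarith)
      nlinarith [mul_nonneg hz hz]
    have h9 : (binom (Function.update k i (k i - (t + 1))) : ℝ) =
        binom k' * ((x - t) / (x - t + z)) := by
      rw [mul_div_assoc', eq_div_iff hNt.ne', h3]
    rw [h9]
    calc _ ≤ (binom k * ((x / (x + z)) ^ t * Real.exp (-(μ * (t * (t - 1)) / (2 * (x + z)))))) *
          (x / (x + z) * Real.exp (-(t * μ / (x + z)))) :=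
          mul_le_mul ih h4 (div_nonneg (by linarith) hNt.le) (by positivity)
      _ = binom k * ((x / (x + z)) ^ (t + 1) * (Real.exp (-(μ * (t * (t - 1)) / (2 * (x + z)))) *
          Real.exp (-(t * μ / (x + z))))) := by ring
      _ = _ := by
          rw [← Real.exp_add]
          congr 3
          push_cast
          field_simp
          ring

theorem HasMonoClique.of_book {V : Type} {H : Bool → SimpleGraph V} {A T Y : Finset V}
    {k : Bool → ℕ} {i : Bool} {t : ℕ} (hT : T ⊆ A) (hY : Y ⊆ A) (hclique : (H i).IsNClique t T)
    (hadj : ∀ v ∈ T, ∀ y ∈ Y, (H i).Adj v y) (ht : t ≤ k i)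
    (h : HasMonoClique H Y (Function.update k i (k i - t))) : HasMonoClique H A k := by
  classical
  obtain ⟨b, S, hS, hSc⟩ := h
  by_cases hb : b = i
  · subst hb
    rw [Function.update_self] at hSc
    refine ⟨b, T ∪ S, Finset.union_subset hT (hS.trans hY), ?_⟩
    constructor
    · have : Std.Symm (H b).Adj := ⟨fun _ _ h => h.symm⟩
      rw [Finset.coe_union, SimpleGraph.isClique_iff, Set.pairwise_union_of_symm]
      exact ⟨hclique.isClique, hSc.isClique, fun v hv y hy _ => hadj v hv y (hS hy)⟩
    · rw [Finset.card_union_of_disjoint, hclique.card_eq, hSc.card_eq]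
      · omega
      · rw [Finset.disjoint_left]
        exact fun v hv hv' => (H b).irrefl (hadj v hv v (hS hv'))
  · rw [Function.update_of_ne hb] at hSc
    exact ⟨b, S, hS.trans hY, hSc⟩

theorem HasMonoClique.of_nbhd {V : Type} {H : Bool → SimpleGraph V} {A : Finset V}
    {k : Bool → ℕ} {i : Bool} {x : V} (hx : x ∈ A) (hk : k i ≠ 0)
    (h : HasMonoClique H (nbhd (H i) x A) (Function.update k i (k i - 1))) :
    HasMonoClique H A k := by
  refine HasMonoClique.of_book (T := {x}) (t := 1) (by simpa using hx) (nbhd_subset (H i) x A)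
    (by simp) ?_ (by omega) h
  intro v hv y hy
  rw [Finset.mem_singleton.1 hv]
  exact (mem_nbhd.1 hy).2

/-- The Erdős–Szekeres bound. -/
theorem hasMonoClique_of_binom_le {V : Type} {H : Bool → SimpleGraph V}
    (hH : ∀ x y, x ≠ y → ∃ i, (H i).Adj x y) {A : Finset V} {k : Bool → ℕ}
    (h : binom k ≤ A.card) : HasMonoClique H A k := by
  induction hn : k true + k false using Nat.strong_induction_on generalizing k A with
  | _ n ih =>
    subst hn
    obtain ⟨x, hx⟩ : A.Nonempty := Finset.card_pos.1 ((binom_pos k).trans_le h)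
    by_cases hk : ∃ i, k i = 0
    · obtain ⟨i, hi⟩ := hk
      exact ⟨i, {x}, by simpa using hx, by simp [hi]⟩
    · push Not at hk
      have h1 := card_le_card_nbhd_add_card_nbhd hH A x
      have h2 := binom_update_add k hk
      have h3 : ∃ i, binom (Function.update k i (k i - 1)) ≤ (nbhd (H i) x A).card := by
        by_contra! hcon
        have h4 := hcon true
        have h5 := hcon false
        omega
      obtain ⟨i, hi⟩ := h3
      refine HasMonoClique.of_nbhd hx (hk i) (ih _ ?_ hi rfl)
      have h6 := hk true
      have h7 := hk false
      cases i <;> simp <;> omega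

/-! ### Choice of parameters and the almost regular case -/

theorem log_eight_div_le {μ M : ℝ} (hμ : 0 < μ) (hM : 1 ≤ M) :
    Real.log (8 / (μ ^ 2 / (192 * M ^ 4))) ≤ (1536 / μ ^ 2 + 4) * M := by
  have h1 : 8 / (μ ^ 2 / (192 * M ^ 4)) = 1536 / μ ^ 2 * M ^ 4 := by
    field_simp
    norm_num
  rw [h1, Real.log_mul (by positivity) (by positivity), Real.log_pow]
  have h2 := Real.log_le_self (x := 1536 / μ ^ 2) (by positivity)
  have h3 := Real.log_le_self (x := M) (by linarith)
  have h4 : 0 < 1536 / μ ^ 2 := by positivity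
  push_cast
  nlinarith

theorem mul_exp_neg_le_sub {μ δ p : ℝ} (hμ : 0 < μ) (hδ : 0 < δ) (h : 4 * δ / μ ≤ 1)
    (hp : μ ≤ p) : p * Real.exp (-(4 * δ / μ)) ≤ p - 2 * δ := by
  set u := 4 * δ / μ with hu
  have hu0 : 0 < u := by positivity
  have h1 : Real.exp (-u) ≤ 1 - u / 2 := by
    rw [Real.exp_neg]
    refine (inv_anti₀ (by positivity) (Real.add_one_le_exp u)).trans ?_
    rw [inv_le_iff_one_le_mul₀ (by positivity)]
    nlinarith
  have h2 : 2 * δ = μ * (u / 2) := by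
    rw [hu]
    field_simp
    ring
  nlinarith

/-- The sum of the logarithmic losses of the reservoir in the book algorithm is small. -/
theorem reservoir_loss_le {μ M t N L L₀ : ℝ} (hμ : 0 < μ) (hM : 1 ≤ M) (ht : 0 < t)
    (htN : t ≤ N / M ^ 4) (hL : L ≤ L₀ * M) (hL₀ : 0 ≤ L₀) :
    2 * t * (3 * M ^ 3 + 8 + 2 * (55296 * t * M / μ ^ 2) / t) +
      2 * (55296 * t * M / μ ^ 2) * L ≤
      (22 + 4 * 55296 / μ ^ 2 + 2 * 55296 * L₀ / μ ^ 2) * (N / M) := by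
  have hM0 : 0 < M := by linarith
  have hM3 : 1 ≤ M ^ 3 := one_le_pow₀ hM
  have h1 : t * M ^ 3 ≤ N / M := by
    calc t * M ^ 3 ≤ N / M ^ 4 * M ^ 3 := by gcongr
      _ = N / M := by field_simp
  have h2 : t * M ≤ t * M ^ 3 := by
    gcongr
    exact le_self_pow₀ hM (by norm_num)
  have h3 : t * M ^ 2 ≤ t * M ^ 3 := by
    have : M ^ 2 ≤ M ^ 3 := pow_le_pow_right₀ hM (by norm_num)
    gcongr
  have h4 : 2 * t * (3 * M ^ 3 + 8 + 2 * (55296 * t * M / μ ^ 2) / t) =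
      6 * (t * M ^ 3) + 16 * t + 4 * 55296 / μ ^ 2 * (t * M) := by
    field_simp
    ring
  have h5 : 2 * (55296 * t * M / μ ^ 2) * L ≤ 2 * 55296 * L₀ / μ ^ 2 * (t * M ^ 2) := by
    calc _ ≤ 2 * (55296 * t * M / μ ^ 2) * (L₀ * M) := by gcongr
      _ = _ := by ring
  have h6 : t ≤ t * M ^ 3 := by nlinarith
  have h7 : 4 * 55296 / μ ^ 2 * (t * M) ≤ 4 * 55296 / μ ^ 2 * (N / M) :=
    mul_le_mul_of_nonneg_left (h2.trans h1) (by positivity)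
  have h8 : 2 * 55296 * L₀ / μ ^ 2 * (t * M ^ 2) ≤ 2 * 55296 * L₀ / μ ^ 2 * (N / M) :=
    mul_le_mul_of_nonneg_left (h3.trans h1) (by positivity)
  rw [h4, add_mul, add_mul]
  linarith

/-- The total loss of the pages in the book algorithm is smaller than the gain of the book over
the Erdős–Szekeres bound. -/
theorem pages_loss_le {μ M t N s L L₀ : ℝ} (hμ : 0 < μ) (hM : 1 ≤ M) (ht : 2 ≤ t)
    (htN : t ≤ N / M ^ 4) (hNt : N / (2 * M ^ 4) ≤ t) (hL : L ≤ L₀ * M) (hL₀ : 0 ≤ L₀)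
    (hM1 : 768 * L₀ / μ ^ 2 ≤ M) (hs : s ≤ 8 * t * L / (M ^ 3) ^ 2) :
    4 * (μ ^ 2 / (192 * M ^ 4)) / μ * t + 2 / μ * s + μ / (48 * M ^ 8) * N ≤
      μ * (t * (t - 1)) / (2 * N) := by
  have hM0 : 0 < M := by linarith
  have hN : 0 < N := by
    have : 0 < N / M ^ 4 := by linarith
    rwa [div_pos_iff_of_pos_right (by positivity)] at this
  have h1 : 4 * (μ ^ 2 / (192 * M ^ 4)) / μ * t ≤ μ * N / (48 * M ^ 8) := by
    calc _ ≤ 4 * (μ ^ 2 / (192 * M ^ 4)) / μ * (N / M ^ 4) := by gcongr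
      _ = _ := by field_simp; norm_num
  have h2 : 2 / μ * s ≤ μ * N / (48 * M ^ 8) := by
    calc 2 / μ * s ≤ 2 / μ * (8 * (N / M ^ 4) * (L₀ * M) / (M ^ 3) ^ 2) := by
          refine mul_le_mul_of_nonneg_left (hs.trans ?_) (by positivity)
          refine div_le_div_of_nonneg_right ?_ (by positivity)
          calc 8 * t * L ≤ 8 * t * (L₀ * M) := by gcongr
            _ ≤ _ := by gcongr
      _ = 768 * L₀ / μ ^ 2 * (μ * N / (48 * M ^ 9)) := by field_simp; ring
      _ ≤ M * (μ * N / (48 * M ^ 9)) := by gcongr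
      _ = _ := by field_simp
  have h3 : μ * N / (16 * M ^ 8) ≤ μ * (t * (t - 1)) / (2 * N) := by
    calc μ * N / (16 * M ^ 8) = μ * ((N / (2 * M ^ 4)) * (N / (2 * M ^ 4)) / 2) / (2 * N) := by
          field_simp; norm_num
      _ ≤ μ * (t * t / 2) / (2 * N) := by gcongr
      _ ≤ _ := by gcongr; nlinarith
  have h4 : μ / (48 * M ^ 8) * N = μ * N / (48 * M ^ 8) := by ring
  have h5 : μ * N / (16 * M ^ 8) = 3 * (μ * N / (48 * M ^ 8)) := by field_simp; norm_num
  linarith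

theorem le_half_mul_of_le {μ M N C : ℝ} (hμ : 0 < μ) (hμ1 : μ ≤ 1) (hM : 1 ≤ M)
    (hM2 : 2 * (C + 2) / μ ≤ M) (hN : 11 * M ^ 10 ≤ N) :
    3 * M ^ 3 + 8 + μ / (48 * M ^ 8) * N + C * (N / M) ≤ μ * N / 2 := by
  have hM0 : 0 < M := by linarith
  have hNpos : 0 < N := lt_of_lt_of_le (by positivity) hN
  have hCN : (C + 2) * (N / M) ≤ μ * N / 2 := by
    rw [div_le_iff₀ hμ] at hM2
    rw [mul_div_assoc', div_le_iff₀ hM0]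
    nlinarith
  have hcN : μ / (48 * M ^ 8) * N ≤ N / M := by
    rw [div_mul_eq_mul_div, div_le_div_iff₀ (by positivity) hM0]
    have h8 : M ≤ M ^ 8 := le_self_pow₀ hM (by norm_num)
    calc μ * N * M ≤ 1 * N * M ^ 8 := by gcongr
      _ ≤ N * (48 * M ^ 8) := by nlinarith [mul_pos hNpos (pow_pos hM0 8)]
  have hJ : 3 * M ^ 3 + 8 ≤ N / M := by
    rw [le_div_iff₀ hM0]
    have h1 : M ^ 3 * M ≤ M ^ 10 := by
      rw [← pow_succ]
      exact pow_le_pow_right₀ hM (by norm_num)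
    have h2 : M ≤ M ^ 10 := le_self_pow₀ hM (by norm_num)
    nlinarith
  linarith

theorem div_pow_four_le {μ M N : ℝ} (hμ : 0 < μ) (hM : 1 ≤ M) (hN : 0 ≤ N) (h : 1 / μ ≤ M) :
    N / M ^ 4 ≤ μ * N := by
  have h3 : M ≤ M ^ 4 := le_self_pow₀ hM (by norm_num)
  rw [div_le_iff₀ (by linarith)]
  rw [div_le_iff₀ hμ] at h
  have : 1 ≤ μ * M ^ 4 := by nlinarith
  nlinarith

/-- Below the Erdős–Szekeres bound by a small exponential factor, an almost regular colouring still
contains the desired cliques. -/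
theorem exists_hasMonoClique_of_degree {μ : ℝ} (hμ : 0 < μ) (hμ1 : μ ≤ 1) :
    ∃ (c δ : ℝ) (N₀ : ℕ), 0 < c ∧ 0 < δ ∧ ∀ (V : Type) (H : Bool → SimpleGraph V)
      (A : Finset V) (k : Bool → ℕ), (∀ x y, x ≠ y → ∃ i, (H i).Adj x y) →
      (N₀ : ℝ) ≤ k true + k false → (∀ i, μ * (k true + k false) ≤ k i) →
      Real.exp (-c * (k true + k false)) * binom k ≤ A.card →
      (∀ i, ∀ x ∈ A, (k i / (k true + k false : ℝ) - δ) * A.card ≤ (nbhd (H i) x A).card) →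
      HasMonoClique H A k := by
  obtain ⟨L₀, hL₀⟩ : ∃ L₀ : ℝ, L₀ = 1536 / μ ^ 2 + 4 := ⟨_, rfl⟩
  obtain ⟨C, hC⟩ : ∃ C : ℝ, C = 22 + 4 * 55296 / μ ^ 2 + 2 * 55296 * L₀ / μ ^ 2 := ⟨_, rfl⟩
  obtain ⟨m, hm⟩ := exists_nat_ge (max (768 * L₀ / μ ^ 2) (max (2 * (C + 2) / μ) 1))
  have hL₀0 : 0 < L₀ := by rw [hL₀]; positivity
  have hC0 : 0 < C := by rw [hC]; positivity
  obtain ⟨M, hMdef⟩ : ∃ M : ℝ, M = m := ⟨_, rfl⟩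
  rw [← hMdef] at hm
  obtain ⟨hM1, hM2, hM⟩ : 768 * L₀ / μ ^ 2 ≤ M ∧ 2 * (C + 2) / μ ≤ M ∧ 1 ≤ M := by
    simpa only [max_le_iff] using hm
  have hM0 : 0 < M := by linarith
  have hm1 : 1 ≤ m := by
    rw [hMdef] at hM
    exact_mod_cast hM
  obtain ⟨δ, hδdef⟩ : ∃ δ : ℝ, δ = μ ^ 2 / (192 * M ^ 4) := ⟨_, rfl⟩
  have hδ : 0 < δ := by rw [hδdef]; positivity
  -- The scales are `t ≈ N/M⁴`, `J = M³`, `δ ≍ M⁻⁴`, `D ≍ tM`. The gain `t²/N` has order `N/M⁸`; the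
  -- losses from `δ`, from boosts (order `N/M⁹`) and from `c` take at most a third of it each. The
  -- reservoir loses only order `N/M` in the exponent, against a binomial coefficient of at least
  -- `exp (μN/2)`.
  refine ⟨μ / (48 * M ^ 8), δ, 11 * m ^ 10, by positivity, hδ, ?_⟩
  intro V H A k hH hN hk hA hdeg
  obtain ⟨N, hNdef⟩ : ∃ N : ℝ, N = k true + k false := ⟨_, rfl⟩
  simp only [← hNdef] at hN hk hA hdeg
  push_cast at hN
  rw [← hMdef] at hN
  have hM4 : 1 ≤ M ^ 4 := one_le_pow₀ hM
  have hM6 : 1 ≤ M ^ 6 := one_le_pow₀ hM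
  have hNpos : 0 < N := lt_of_lt_of_le (by positivity) hN
  have hNM : 11 * M ^ 6 ≤ N / M ^ 4 := by
    rw [le_div_iff₀ (by positivity)]
    calc 11 * M ^ 6 * M ^ 4 = 11 * M ^ 10 := by ring
      _ ≤ N := hN
  obtain ⟨t, htN, htlt⟩ : ∃ t : ℕ, (t : ℝ) ≤ N / M ^ 4 ∧ N / M ^ 4 < t + 1 :=
    ⟨_, Nat.floor_le (by positivity), Nat.lt_floor_add_one _⟩
  have ht10 : (10 : ℝ) * M ^ 6 ≤ t := by linarith
  have ht2 : (2 : ℝ) ≤ t := by linarith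
  have hNt : N / (2 * M ^ 4) ≤ t := by
    have : N / (2 * M ^ 4) = N / M ^ 4 / 2 := by field_simp
    rw [this]
    linarith
  have hδμ : 4 * δ ≤ μ := by
    rw [hδdef, mul_div_assoc', div_le_iff₀ (by positivity)]
    calc 4 * μ ^ 2 = 4 * μ * μ := by ring
      _ ≤ 4 * μ * 1 := by gcongr
      _ ≤ μ * (192 * M ^ 4) := by nlinarith only [hμ, hM4]
  have hL := log_eight_div_le hμ hM
  rw [← hδdef, ← hL₀] at hL
  obtain ⟨D, hD⟩ : ∃ D : ℝ, D = 55296 * t * M / μ ^ 2 := ⟨_, rfl⟩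
  obtain ⟨K, hK⟩ : ∃ K : ℝ, K = 3 * M ^ 3 + 8 + 2 * D / t := ⟨_, rfl⟩
  have hp : ∀ i, μ ≤ k i / N := fun i => (le_div_iff₀ hNpos).2 (hk i)
  -- One `δ` is the irregularity of the colouring; the algorithm gives up another, so the pages have
  -- density at least `k i / N - 2δ` per step.
  have P : BookParameters (fun i => k i / N - δ) δ D K t (m ^ 3) := by
    constructor
    · exact hδ
    · intro i
      have := hp i
      show δ < k i / N - δ
      linarith
    · exact_mod_cast ht2
    · exact Nat.one_le_pow _ _ hm1
    · push_cast
      rw [← hMdef]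
      have h6 : (M ^ 3) ^ 2 = M ^ 6 := by ring
      linarith
    · push_cast
      rw [← hMdef, hD, hδdef]
      apply le_of_eq
      field_simp
      norm_num
    · push_cast
      rw [← hMdef, hK]
  have hloss := reservoir_loss_le hμ hM (by linarith : (0 : ℝ) < t) htN hL hL₀0.le
  rw [← hD, ← hK, ← hC] at hloss
  have hexp := le_half_mul_of_le hμ hμ1 hM hM2 hN
  have hbig : Real.exp (3 * (m ^ 3 : ℕ) + 8) ≤
      A.card * Real.exp (-(2 * t * K) - 2 * D * Real.log (1 / δ)) := by
    have h1 := exp_half_mul_le_binom hk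
    have hlog : Real.log (1 / δ) ≤ Real.log (8 / δ) := by
      apply Real.log_le_log (by positivity)
      gcongr
      norm_num
    have hD0 : 0 < D := P.D_pos
    have h2 : 2 * D * Real.log (1 / δ) ≤ 2 * D * Real.log (8 / δ) := by gcongr
    push_cast
    rw [← hMdef]
    calc Real.exp (3 * M ^ 3 + 8) ≤ Real.exp (-(μ / (48 * M ^ 8)) * N) * Real.exp (μ * N / 2) *
          Real.exp (-(2 * t * K) - 2 * D * Real.log (1 / δ)) := by
          rw [← Real.exp_add, ← Real.exp_add]
          apply Real.exp_le_exp.2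
          linarith
      _ ≤ _ := by
          gcongr
          exact le_trans (by gcongr) hA
  obtain ⟨i, T, Y, s, hT, hY, hTc, hadj, hcard, hs⟩ := exists_book P hH hbig hdeg
  push_cast at hs
  rw [← hMdef] at hs
  have htk : t ≤ k i := by
    have h2 : 1 / μ ≤ M := by
      refine le_trans ?_ hM2
      gcongr
      linarith
    have h1 : (t : ℝ) ≤ k i := (htN.trans (div_pow_four_le hμ hM hNpos.le h2)).trans (hk i)
    exact_mod_cast h1
  refine HasMonoClique.of_book hT hY hTc hadj htk (hasMonoClique_of_binom_le hH ?_)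
  have hfinal := pages_loss_le hμ hM ht2 htN hNt hL hL₀0.le hM1 hs
  rw [← hδdef] at hfinal
  have h4 : (binom (Function.update k i (k i - t)) : ℝ) ≤ _ :=
    binom_update_sub_le hμ.le (hNdef ▸ hk !i) htk
  rw [← hNdef] at h4
  have hp0 : 0 < k i / N - δ - δ := by linarith [hp i]
  -- The `t` spine steps lose only `exp (-4δ/μ)` each against `k i / N`, while each of the `s`
  -- boosts is charged a full constant factor `exp (-2/μ)`.
  have h5 : (k i / N) ^ t * Real.exp (-(4 * δ / μ * t + 2 / μ * s)) ≤
      (k i / N - δ - δ) ^ (t + s) := by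
    have h6 : k i / N * Real.exp (-(4 * δ / μ)) ≤ k i / N - δ - δ := by
      have := mul_exp_neg_le_sub hμ hδ ((div_le_one hμ).2 hδμ) (hp i)
      linarith
    have h7 : Real.exp (-(2 / μ)) ≤ k i / N - δ - δ := by
      have h8 : Real.exp (-(2 / μ)) ≤ μ / 2 := by
        rw [Real.exp_neg, ← inv_div 2 μ]
        apply inv_anti₀ (by positivity)
        linarith [Real.add_one_le_exp (2 / μ)]
      linarith [hp i]
    calc _ = (k i / N * Real.exp (-(4 * δ / μ))) ^ t * Real.exp (-(2 / μ)) ^ s := by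
          rw [mul_pow, ← Real.exp_nat_mul, ← Real.exp_nat_mul, mul_assoc, ← Real.exp_add]
          congr 2
          ring
      _ ≤ (k i / N - δ - δ) ^ t * (k i / N - δ - δ) ^ s := by
          have := hp i
          gcongr
      _ = _ := (pow_add _ _ _).symm
  have h9 : (binom (Function.update k i (k i - t)) : ℝ) ≤ Y.card := by
    refine h4.trans (le_trans ?_ hcard)
    calc _ ≤ binom k * ((k i / N) ^ t * Real.exp (-(4 * δ / μ * t + 2 / μ * s) +
          -(μ / (48 * M ^ 8)) * N)) := by
          gcongr
          linarith
      _ = ((k i / N) ^ t * Real.exp (-(4 * δ / μ * t + 2 / μ * s))) *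
          (Real.exp (-(μ / (48 * M ^ 8)) * N) * binom k) := by
          rw [Real.exp_add]
          ring
      _ ≤ _ := by gcongr
  exact_mod_cast h9

/-! ### Density increment -/

/-- A deficit of `δ|A|` in one colour is a surplus in the other, up to the vertex `x` itself; half
of the surplus absorbs this 1. -/
theorem exists_dense_nbhd {V : Type} {H : Bool → SimpleGraph V} {A : Finset V} {k : Bool → ℕ}
    {δ n : ℝ} (hH : ∀ x y, x ≠ y → ∃ i, (H i).Adj x y) (hn : n = k true + k false) (hn0 : 0 < n)
    (hA : 1 ≤ δ / 2 * A.card)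
    (hdeg : ¬ ∀ i, ∀ x ∈ A, (k i / n - δ) * A.card ≤ (nbhd (H i) x A).card) :
    ∃ i, ∃ x ∈ A, (k i : ℝ) / n * ((1 + δ / 2) * A.card) ≤ (nbhd (H i) x A).card := by
  push Not at hdeg
  obtain ⟨i, x, hx, hlt⟩ := hdeg
  refine ⟨!i, x, hx, ?_⟩
  have hcover : (A.card : ℝ) ≤ (nbhd (H i) x A).card + (nbhd (H !i) x A).card + 1 := by
    have := card_le_card_nbhd_add_card_nbhd hH A x
    have h' : A.card ≤ (nbhd (H i) x A).card + (nbhd (H !i) x A).card + 1 := by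
      cases i
      · simpa [add_comm] using this
      · simpa using this
    exact_mod_cast h'
  have hsum : n = k i + k !i := by
    rw [hn]
    exact_mod_cast sum_eq k i
  have hfrac : (k i : ℝ) / n = 1 - k (!i) / n := by
    rw [eq_sub_iff_add_eq, ← add_div, ← hsum, div_self hn0.ne']
  have hfrac1 : (k (!i) : ℝ) / n ≤ 1 := by
    have : (0 : ℝ) ≤ k i / n := by positivity
    linarith
  rw [hfrac] at hlt
  have : (k (!i) : ℝ) / n * (δ / 2 * A.card) ≤ 1 * (δ / 2 * A.card) := by gcongr
  linarith

theorem binom_update_pred {k : Bool → ℕ} {i : Bool} (h : k i ≠ 0) :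
    (binom (Function.update k i (k i - 1)) : ℝ) =
      binom k * (k i / (k true + k false : ℝ)) := by
  have h1 := binom_update_mul k i (n := k i - 1) (by omega)
  have h2 : (0 : ℝ) < k true + k false := by
    have : 0 < k true + k false := by cases i <;> omega
    exact_mod_cast this
  rw [mul_div_assoc', eq_div_iff h2.ne']
  exact_mod_cast h1

theorem sum_update_pred {k : Bool → ℕ} {i : Bool} (h : k i ≠ 0) :
    (Function.update k i (k i - 1) true : ℝ) + Function.update k i (k i - 1) false =
      k true + k false - 1 := by
  have hcast : ((k i - 1 : ℕ) : ℝ) = k i - 1 := by push_cast [Nat.one_le_iff_ne_zero.2 h]; ring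
  cases i <;> simp only [Function.update_self, ne_eq, reduceCtorEq, not_false_eq_true,
    Function.update_of_ne, hcast] <;> ring

/-- An exponential improvement of the Erdős–Szekeres bound in every sector `k i ≥ μ (k₁ + k₂)`. -/
theorem exists_hasMonoClique_of_exp_mul_binom_le {μ : ℝ} (hμ : 0 < μ) (hμ1 : μ ≤ 1) :
    ∃ (c : ℝ) (N₀ : ℕ), 0 < c ∧ ∀ (V : Type) (H : Bool → SimpleGraph V)
      (A : Finset V) (k : Bool → ℕ), (∀ x y, x ≠ y → ∃ i, (H i).Adj x y) →
      (N₀ : ℝ) ≤ k true + k false → (∀ i, μ * (k true + k false) ≤ k i) →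
      Real.exp (-c * (k true + k false)) * binom k ≤ A.card → HasMonoClique H A k := by
  obtain ⟨c, δ, N₁, hc, hδ, hbook⟩ := exists_hasMonoClique_of_degree (μ := μ / 2) (by positivity)
    (by linarith)
  -- The bounds on `κ` keep every `k i` above `μN/2` during `κN` steps, keep `A` large enough for
  -- the almost regular case, and keep `δ|A| ≥ 2`.
  obtain ⟨κ, hκ, hκ1, hκ2, hκ3⟩ : ∃ κ : ℝ, 0 < κ ∧ κ ≤ μ / 2 ∧ δ * κ ≤ c ∧ δ * κ ≤ μ / 4 := by
    refine ⟨min (μ / 2) (min (c / δ) (μ / 4 / δ)), by positivity, min_le_left _ _, ?_, ?_⟩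
    · have : min (μ / 2) (min (c / δ) (μ / 4 / δ)) ≤ c / δ :=
        (min_le_right _ _).trans (min_le_left _ _)
      rwa [le_div_iff₀ hδ, mul_comm] at this
    · have : min (μ / 2) (min (c / δ) (μ / 4 / δ)) ≤ μ / 4 / δ :=
        (min_le_right _ _).trans (min_le_right _ _)
      rwa [le_div_iff₀ hδ, mul_comm] at this
  obtain ⟨N₀, hN₀⟩ := exists_nat_ge (max (2 * N₁ : ℝ) (max (16 / (μ * δ)) (2 / κ)))
  obtain ⟨hN1, hN2, hN3⟩ : (2 * N₁ : ℝ) ≤ N₀ ∧ 16 / (μ * δ) ≤ N₀ ∧ 2 / κ ≤ N₀ := by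
    simpa only [max_le_iff] using hN₀
  have hg : 0 < Real.log (1 + δ / 2) := Real.log_pos (by linarith)
  refine ⟨Real.log (1 + δ / 2) * κ / 2, N₀, by positivity, ?_⟩
  intro V H A k hH hN hk hA
  obtain ⟨N, hNdef⟩ : ∃ N : ℝ, N = k true + k false := ⟨_, rfl⟩
  simp only [← hNdef] at hN hk hA
  have hNpos : 0 < N := lt_of_lt_of_le (lt_of_lt_of_le (by positivity) hN3) hN
  -- Here `j` counts the remaining steps: each irregular vertex gains one factor `1 + δ/2`, and at
  -- `j = 0` Erdős–Szekeres applies.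
  have main : ∀ (j : ℕ) (A : Finset V) (k : Bool → ℕ), (j : ℝ) ≤ κ * N →
      (∀ i, μ / 2 * N + j ≤ k i) → (k true + k false : ℝ) ≤ N →
      N / 2 + j ≤ (k true + k false : ℝ) → (binom k : ℝ) ≤ (1 + δ / 2) ^ j * A.card →
      HasMonoClique H A k := by
    intro j
    induction j with
    | zero =>
      intro A k _ _ _ _ h
      refine hasMonoClique_of_binom_le hH ?_
      rw [pow_zero, one_mul] at h
      exact_mod_cast h
    | succ j ih =>
      intro A k hj hki hle hge h
      push_cast at hj hki hge
      have hj0 : (0 : ℝ) ≤ j := Nat.cast_nonneg j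
      obtain ⟨n, hn⟩ : ∃ n : ℝ, n = k true + k false := ⟨_, rfl⟩
      rw [← hn] at hle hge
      have hn0 : 0 < n := by linarith
      have hpow : (1 + δ / 2) ^ (j + 1) ≤ Real.exp (δ * κ * N / 2) := by
        calc (1 + δ / 2) ^ (j + 1) ≤ Real.exp (δ / 2) ^ (j + 1) := by
              gcongr
              linarith [Real.add_one_le_exp (δ / 2)]
          _ = Real.exp ((j + 1 : ℕ) * (δ / 2)) := (Real.exp_nat_mul _ _).symm
          _ ≤ _ := by
              apply Real.exp_le_exp.2
              push_cast
              linarith only [mul_le_mul_of_nonneg_left hj hδ.le]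
      have hA : Real.exp (-(δ * κ * N / 2)) * binom k ≤ A.card := by
        rw [Real.exp_neg, inv_mul_le_iff₀ (Real.exp_pos _)]
        exact h.trans (by gcongr)
      by_cases hdeg : ∀ i, ∀ x ∈ A, (k i / n - δ) * A.card ≤ (nbhd (H i) x A).card
      · rw [hn] at hdeg
        refine hbook V H A k hH ?_ (fun i => ?_) (le_trans ?_ hA) hdeg
        · rw [← hn]
          linarith only [hge, hN1, hN, hj0]
        · rw [← hn]
          have := mul_le_mul_of_nonneg_left hle hμ.le
          linarith only [this, hki i, hj0]
        · rw [← hn]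
          gcongr
          have h1 := mul_le_mul_of_nonneg_right hκ2 hNpos.le
          have h2 : c * (N / 2) ≤ c * n := by gcongr; linarith only [hge, hj0]
          linarith only [h1, h2]
      · have hAbig : 1 ≤ δ / 2 * A.card := by
          have h1 := exp_half_mul_le_binom (k := k) (r := μ / 2 * N) (fun i => by linarith [hki i])
          have h2 : μ * N / 8 ≤ A.card := by
            calc μ * N / 8 ≤ Real.exp (μ * N / 8) := by linarith [Real.add_one_le_exp (μ * N / 8)]
              _ ≤ Real.exp (-(δ * κ * N / 2)) * Real.exp (μ / 2 * N / 2) := by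
                  rw [← Real.exp_add]
                  apply Real.exp_le_exp.2
                  have := mul_le_mul_of_nonneg_right hκ3 hNpos.le
                  linarith only [this]
              _ ≤ Real.exp (-(δ * κ * N / 2)) * binom k := by gcongr
              _ ≤ _ := hA
          have h3 : 16 / (μ * δ) ≤ N := hN2.trans hN
          rw [div_le_iff₀ (by positivity)] at h3
          have h4 := mul_le_mul_of_nonneg_left h2 hδ.le
          linarith only [h3, h4]
        obtain ⟨i, x, hx, hgain⟩ := exists_dense_nbhd hH hn hn0 hAbig hdeg
        have hpos : (0 : ℝ) < k i := by
          have : 0 ≤ μ / 2 * N := by positivity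
          linarith only [this, hki i, hj0]
        have hk0 : k i ≠ 0 := fun h0 => by simp [h0] at hpos
        have hcast : ((k i - 1 : ℕ) : ℝ) = k i - 1 := by
          push_cast [Nat.one_le_iff_ne_zero.2 hk0]; ring
        have hsum := sum_update_pred hk0
        rw [← hn] at hsum
        refine HasMonoClique.of_nbhd hx hk0 (ih _ _ (by linarith only [hj]) (fun b => ?_)
          (by rw [hsum]; linarith only [hle]) (by rw [hsum]; linarith only [hge]) ?_)
        · by_cases hb : b = i
          · subst hb
            rw [Function.update_self, hcast]
            linarith only [hki b]
          · rw [Function.update_of_ne hb]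
            linarith only [hki b]
        · rw [binom_update_pred hk0, ← hn]
          calc _ ≤ (1 + δ / 2) ^ (j + 1) * A.card * (k i / n) := by gcongr
            _ = (1 + δ / 2) ^ j * ((k i : ℝ) / n * ((1 + δ / 2) * A.card)) := by ring
            _ ≤ _ := by gcongr
  have hfl : (⌊κ * N⌋₊ : ℝ) ≤ κ * N := Nat.floor_le (by positivity)
  have hκN : 2 ≤ κ * N := by
    have := hN3.trans hN
    rwa [div_le_iff₀ hκ, mul_comm] at this
  have hfl2 : κ * N / 2 ≤ ⌊κ * N⌋₊ := by linarith [Nat.lt_floor_add_one (κ * N)]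
  have hκN2 : κ * N ≤ μ / 2 * N := by gcongr
  refine main ⌊κ * N⌋₊ A k hfl (fun i => ?_) hNdef.ge ?_ ?_
  · linarith only [hk i, hfl, hκN2]
  · rw [← hNdef]
    have : μ * N ≤ 1 * N := by gcongr
    linarith only [hfl, hκN2, this]
  · have h1 : Real.exp (Real.log (1 + δ / 2) * κ / 2 * N) ≤ (1 + δ / 2) ^ ⌊κ * N⌋₊ := by
      calc _ ≤ Real.exp (⌊κ * N⌋₊ * Real.log (1 + δ / 2)) := by
            apply Real.exp_le_exp.2
            have := mul_le_mul_of_nonneg_right hfl2 hg.le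
            linarith only [this]
        _ = _ := by rw [Real.exp_nat_mul, Real.exp_log (by linarith)]
    rw [neg_mul, Real.exp_neg, inv_mul_le_iff₀ (Real.exp_pos _)] at hA
    exact hA.trans (by gcongr)

/-! ### Return to Ramsey numbers -/

theorem ramseyNumber_le_of_hasMonoClique {k l n : ℕ} (hn : 0 < n)
    (h : ∀ H : Bool → SimpleGraph (Fin n), (∀ x y, x ≠ y → ∃ i, (H i).Adj x y) →
      HasMonoClique H Finset.univ (fun b => bif b then k else l)) :
    ramseyNumber (k + 1) (l + 1) ≤ n := by
  refine (ramseyNumber_isLeast _ _).2 ⟨hn, fun G => ?_⟩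
  obtain ⟨i, s, -, hs⟩ := h (fun b => bif b then G else Gᶜ) fun x y hxy => by
    by_cases hG : G.Adj x y
    · exact ⟨true, hG⟩
    · exact ⟨false, (SimpleGraph.compl_adj _ _ _).2 ⟨hxy, hG⟩⟩
  cases i
  · exact Or.inr ⟨s, (SimpleGraph.isNClique_compl G).1 hs⟩
  · exact Or.inl ⟨s, hs⟩

theorem log_sq_le_four_mul (k : ℕ) : Real.log k ^ 2 ≤ 4 * k := by
  rcases Nat.eq_zero_or_pos k with rfl | hk
  · simp
  · have hk1 : (1 : ℝ) ≤ k := by exact_mod_cast hk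
    have h1 := Real.log_sqrt (x := (k : ℝ)) (by linarith)
    have h2 := Real.log_le_self (Real.sqrt_nonneg (k : ℝ))
    have h3 := Real.sq_sqrt (x := (k : ℝ)) (by linarith)
    have h4 := Real.log_nonneg hk1
    nlinarith

theorem theorem2 (ε : ℝ) (hε : ε ∈ Set.Ioo (0 : ℝ) (1 / 2)) :
    ∃ c : ℝ, 0 < c ∧ ∀ k l : ℕ, (l : ℝ) / (k : ℝ) ∈ Set.Icc ε 1 → c⁻¹ ≤ (l : ℝ) →
      (ramseyNumber (k + 1) (l + 1) : ℝ) ≤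
        Real.exp (-c * (Real.log (k : ℝ)) ^ 2) * ((k + l).choose k : ℝ) := by
  obtain ⟨hε0, hε1⟩ := hε
  obtain ⟨c₁, N₀, hc₁, hmono⟩ := exists_hasMonoClique_of_exp_mul_binom_le (μ := ε / 2)
    (by positivity) (by linarith)
  set c₂ := min c₁ (ε / 4) with hc₂
  have hc₂0 : 0 < c₂ := by positivity
  have hc₂1 : c₂ ≤ c₁ := min_le_left _ _
  have hc₂2 : c₂ ≤ ε / 4 := min_le_right _ _
  -- The factor `1/8` makes `c (log k)² ≤ c₂N/2`, leaving half the exponential saving to spare, and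
  -- gives `c₂N ≥ 8`; `1/(N₀ + 1)` forces `N ≥ N₀`.
  set c := min (c₂ / 8) (1 / (N₀ + 1 : ℝ)) with hc
  have hc0 : 0 < c := by positivity
  have hc8 : c ≤ c₂ / 8 := min_le_left _ _
  refine ⟨c, hc0, fun k l hkl hl => ?_⟩
  obtain ⟨hkl1, hkl2⟩ := hkl
  have hk0 : (0 : ℝ) < k := by
    rcases Nat.eq_zero_or_pos k with rfl | hk
    · simp only [Nat.cast_zero, div_zero] at hkl1
      linarith
    · exact_mod_cast hk
  rw [le_div_iff₀ hk0] at hkl1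
  rw [div_le_one hk0] at hkl2
  set N : ℝ := k + l with hN
  have hN₀ : (N₀ : ℝ) ≤ N := by
    have h1 : (N₀ + 1 : ℝ) ≤ c⁻¹ := by
      rw [le_inv_comm₀ (by positivity) hc0, ← one_div]
      exact min_le_right _ _
    linarith
  have hN2 : 8 ≤ c₂ * N := by
    have h1 : (c₂ / 8)⁻¹ ≤ N := (inv_anti₀ hc0 hc8).trans (by linarith)
    rw [inv_div, div_le_iff₀ hc₂0] at h1
    linarith
  set κ : Bool → ℕ := fun b => bif b then k else l with hκ
  -- From `l ≤ k`, `N ≤ 2k`, so `l ≥ εk ≥ εN/2`.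
  have hsector : ∀ i, ε / 2 * N ≤ κ i := by
    intro i
    cases i
    · show ε / 2 * (k + l) ≤ (l : ℝ)
      nlinarith
    · show ε / 2 * (k + l) ≤ (k : ℝ)
      nlinarith
  have hbinom := exp_half_mul_le_binom hsector
  have hbk : binom κ = (k + l).choose k := rfl
  rw [← hbk]
  set B := Real.exp (-c * Real.log k ^ 2) * (binom κ : ℝ) with hB
  have hBlower : Real.exp (-(c₂ * N / 2)) * binom κ ≤ B := by
    rw [hB]
    gcongr
    have := log_sq_le_four_mul k
    nlinarith
  have hB1 : 1 ≤ B := by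
    refine le_trans ?_ hBlower
    calc (1 : ℝ) ≤ Real.exp (-(c₂ * N / 2)) * Real.exp (ε / 2 * N / 2) := by
          rw [← Real.exp_add]
          apply Real.one_le_exp
          nlinarith
      _ ≤ _ := by gcongr
  have hfloor : B / 2 ≤ ⌊B⌋₊ := by
    have h1 : (1 : ℝ) ≤ ⌊B⌋₊ := by exact_mod_cast (Nat.one_le_floor_iff B).2 hB1
    linarith [Nat.lt_floor_add_one B]
  have hle : ramseyNumber (k + 1) (l + 1) ≤ ⌊B⌋₊ := by
    refine ramseyNumber_le_of_hasMonoClique (Nat.floor_pos.2 hB1) fun H hH =>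
      hmono _ H Finset.univ κ hH hN₀ hsector ?_
    rw [Finset.card_univ, Fintype.card_fin]
    refine le_trans ?_ hfloor
    show Real.exp (-c₁ * N) * binom κ ≤ B / 2
    -- The spare saving absorbs the factor 2 lost in rounding `B` down to an integer.
    have h2 : Real.exp (-c₁ * N) ≤ Real.exp (-(c₂ * N / 2)) / 2 := by
      calc Real.exp (-c₁ * N) ≤ Real.exp (-(c₂ * N / 2)) * Real.exp (-1) := by
            rw [← Real.exp_add]
            apply Real.exp_le_exp.2
            nlinarith
        _ ≤ Real.exp (-(c₂ * N / 2)) * (1 / 2) := by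
            gcongr
            rw [Real.exp_neg, one_div]
            apply inv_anti₀ (by norm_num)
            linarith [Real.add_one_le_exp (1 : ℝ)]
        _ = _ := by ring
    calc _ ≤ Real.exp (-(c₂ * N / 2)) / 2 * binom κ := by gcongr
      _ = (Real.exp (-(c₂ * N / 2)) * binom κ) / 2 := by ring
      _ ≤ B / 2 := by gcongr
  calc (ramseyNumber (k + 1) (l + 1) : ℝ) ≤ (⌊B⌋₊ : ℝ) := by exact_mod_cast hle
    _ ≤ B := Nat.floor_le (by linarith)
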